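/- Let $a>0$ and let $q:[-a,a]\to\mathbb{C}$ be continuous. Consider the Goursat problem $$\frac{\partial^2 H(u,v)}{\partial u\,\partial v}=q(u+v)H(u,v)\quad(|u|+|v|<a),\qquad H(u,0)=\frac12\int_0^u q(s)\,ds,\quad H(0,v)=0\quad(|u|,|v|\le a),$$ where a solution is a function $H:\{|u|+|v|\le a\}\to\mathbb{C}$ that is continuous, has the mixed derivative $\partial_u(\partial_v H)$ on $\{|u|+|v|<a\}$, and satisfies these equations. This problem has exactly one solution $H$. For $|x|,|t|\le a$ and $h\in\mathbb{C}$ put $$K(x,t)=H\Big(\frac{x+t}{2},\frac{x-t}{2}\Big),\qquad \mathbf{K}(x,t;h)=\frac h2+K(x,t)+\frac h2\int_t^x\big(K(x,s)-K(x,-s)\big)\,ds,$$ and let $\mathbf{T}_h$ be the parametrized transmutation operator $$\mathbf{T}_hu(x)=u(x)+\int_{-x}^{x}\mathbf{K}(x,t;h)u(t)\,dt,\qquad x\in[-a,a].$$ Then, for every $h\in\mathbb{C}$, $\mathbf{T}_h$ is a linear bijection of $C[-a,a]$ onto itself, continuous together with its inverse in the topology of uniform convergence, and a function $u\in C[-a,a]$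 belongs to $C^2[-a,a]$ if and only if $\mathbf{T}_hu$ does; in particular $\mathbf{T}_h$ restricts to a bijection of $C^2[-a,a]$ onto itself. Its inverse is the Volterra integral operator $$\mathbf{T}_h^{-1}u(x)=u(x)-\int_{-x}^{x}\mathbf{K}(t,x;h)u(t)\,dt,\qquad x\in[-a,a].$$ -/

import Mathlib

namespace Transmutation

/-- The closed square `|u| + |v| ≤ a`. It corresponds to `|x| ≤ a, |t| ≤ a` under
`u = (x + t) / 2`, `v = (x - t) / 2`. -/
def diamond (a : ℝ) : Set (ℝ × ℝ) := {p | |p.1| + |p.2| ≤ a}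

/-- `H` is a solution on `|u| + |v| ≤ a` of the Goursat problem
`∂²H/∂u∂v = q(u + v) H(u, v)`, `H(u, 0) = (1/2) ∫₀ᵘ q(s) ds`, `H(0, v) = 0`:
it is continuous on the closed square, the mixed derivative exists in the open square and
satisfies the equation there, and the boundary conditions hold. -/
structure IsGoursatSolution (a : ℝ) (q : ℝ → ℂ) (H : ℝ → ℝ → ℂ) : Prop where
  continuousOn : ContinuousOn (Function.uncurry H) (diamond a)
  differentiableAt : ∀ u v : ℝ, |u| + |v| < a → DifferentiableAt ℝ (fun v' => H u v') v
  equation : ∀ u v : ℝ, |u| + |v| < a →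
    HasDerivAt (fun u' => deriv (fun v' => H u' v') v) (q (u + v) * H u v) u
  boundary_left : ∀ u : ℝ, |u| ≤ a → H u 0 = (1 / 2 : ℂ) * ∫ s in (0 : ℝ)..u, q s
  boundary_right : ∀ v : ℝ, |v| ≤ a → H 0 v = 0

/-- The kernel `K(x, t) = H((x + t)/2, (x - t)/2)`. -/
noncomputable def kernel (H : ℝ → ℝ → ℂ) (x t : ℝ) : ℂ := H ((x + t) / 2) ((x - t) / 2)

/-- The parametrized kernel
`𝐊(x, t; h) = h/2 + K(x, t) + (h/2) ∫ₜˣ (K(x, s) - K(x, -s)) ds`. -/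
noncomputable def paramKernel (H : ℝ → ℝ → ℂ) (h : ℂ) (x t : ℝ) : ℂ :=
  h / 2 + kernel H x t + h / 2 * ∫ s in t..x, (kernel H x s - kernel H x (-s))

/-- `𝐓_h u(x) = u(x) + ∫_{-x}^{x} 𝐊(x, t; h) u(t) dt`. -/
noncomputable def transmutation (H : ℝ → ℝ → ℂ) (h : ℂ) (u : ℝ → ℂ) (x : ℝ) : ℂ :=
  u x + ∫ t in (-x)..x, paramKernel H h x t * u t

/-- The Volterra operator `u(x) - ∫_{-x}^{x} 𝐊(t, x; h) u(t) dt`. -/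
noncomputable def swappedVolterra (H : ℝ → ℝ → ℂ) (h : ℂ) (u : ℝ → ℂ) (x : ℝ) : ℂ :=
  u x - ∫ t in (-x)..x, paramKernel H h t x * u t

/-- A continuous function on `[-a, a]`, as a function on `ℝ` (constant to the left of `-a` and
to the right of `a`; only the values on `[-a, a]` matter below). -/
noncomputable def ext {a : ℝ} (ha : -a ≤ a) (u : C(Set.Icc (-a) a, ℂ)) : ℝ → ℂ :=
  Set.IccExtend ha u

/-- `u` belongs to `C²[-a, a]`. -/
def IsC2 {a : ℝ} (ha : -a ≤ a) (u : C(Set.Icc (-a) a, ℂ)) : Prop :=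
  ContDiffOn ℝ 2 (ext ha u) (Set.Icc (-a) a)

end Transmutation

open Set Filter Topology MeasureTheory intervalIntegral

namespace Transmutation

/-! Write `T_h`, `S_h` for the operators `transmutation H h`, `swappedVolterra H h`, and `V u(x) =
∫_{-x}^{x} u`. Extending `q` continuously and boundedly to `ℝ` gives a Goursat solution on the whole
plane (`exists_isGlobalGoursat`). By uniqueness (`IsGoursatSolution.eqOn`) it agrees with every
solution on the closed square, so the operators can be studied on functions on `ℝ`.

For `h = 0` the Goursat problem is exactly what makes `(T_0 u)'' - q T_0 u = T_0 u''` and `(S_0 u)''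
= S_0 (u'' - q u)`. Hence `S_0 T_0` commutes with the second derivative and preserves the values of
`u` and `u'` at `0`. Induction on the degree shows that it fixes polynomials, and Weierstrass
approximation that it is the identity. As a Volterra operator of the second kind `S_0` is injective,
so `T_0 S_0` is the identity too.

The parameter enters through the factorizations `T_h = T_0 (1 + (h/2) V)` (`transmutation_eq`) and
`S_h = (1 - (h/2) V) S_0` (`swappedVolterra_eq`). Since `V u` is odd, `V² = 0`, so the two factors
containing `V` are mutually inverse and `S_h = T_h⁻¹`.

All these operators preserve `C²` on the line, and a `C²` function on `[-a, a]` extends to a `C²`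
function on `ℝ`; applied to both `T_h` and `S_h` this gives the equivalence. -/

/-! ### Leibniz rule and growth estimates for integrals -/

/-- The map `(y, z) ↦ ∫₀ᶻ F(y, t) dt` has two continuous partial derivatives, hence is strictly
differentiable; the chain rule along the diagonal `y = z` finishes. -/
theorem hasDerivAt_integral_self {F F' : ℝ → ℝ → ℂ} (hF : Continuous (Function.uncurry F))
    (hF' : Continuous (Function.uncurry F'))
    (hd : ∀ x t, HasDerivAt (fun y => F y t) (F' x t) x) (x : ℝ) :
    HasDerivAt (fun y => ∫ t in (0 : ℝ)..y, F y t) (F x x + ∫ t in (0 : ℝ)..x, F' x t) x := by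
  have hfst : ∀ y z : ℝ, HasDerivAt (fun y => ∫ t in (0 : ℝ)..z, F y t)
      (∫ t in (0 : ℝ)..z, F' y t) y := by
    intro y z
    obtain ⟨C, hC⟩ := ((isCompact_Icc (a := y - 1) (b := y + 1)).prod
      (isCompact_uIcc (a := (0 : ℝ)) (b := z))).exists_bound_of_continuousOn hF'.continuousOn
    refine (intervalIntegral.hasDerivAt_integral_of_dominated_loc_of_deriv_le
      (F := F) (F' := F') (bound := fun _ => C) (Icc_mem_nhds (sub_one_lt y) (lt_add_one y))
      (Eventually.of_forall fun w => ?_) ?_ ?_ (Eventually.of_forall fun t ht w hw => ?_)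
      intervalIntegrable_const (Eventually.of_forall fun t _ w _ => hd w t)).2
    · exact (hF.comp (Continuous.prodMk_right w)).aestronglyMeasurable
    · exact (hF.comp (Continuous.prodMk_right y)).intervalIntegrable _ _
    · exact (hF'.comp (Continuous.prodMk_right y)).aestronglyMeasurable
    · exact hC (w, t) ⟨hw, uIoc_subset_uIcc ht⟩
  have hsnd : ∀ y z : ℝ, HasDerivAt (fun z => ∫ t in (0 : ℝ)..z, F y t) (F y z) z := fun y z =>
    (hF.comp (Continuous.prodMk_right y)).integral_hasStrictDerivAt 0 z |>.hasDerivAt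
  have key := (hasStrictFDerivAt_uncurry_coprod (𝕜 := ℝ) (u := (x, x))
    (f := fun y z => ∫ t in (0 : ℝ)..z, F y t)
    (f₁ := fun y z => ContinuousLinearMap.toSpanSingleton ℝ (∫ t in (0 : ℝ)..z, F' y t))
    (f₂ := fun y z => ContinuousLinearMap.toSpanSingleton ℝ (F y z))
    (Eventually.of_forall fun v => (hfst v.1 v.2).hasFDerivAt)
    (Eventually.of_forall fun v => (hsnd v.1 v.2).hasFDerivAt)
    (Continuous.continuousAt ((ContinuousLinearMap.toSpanSingletonCLE
      (𝕜 := ℝ) (E := ℂ)).continuous.comp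
        (continuous_parametric_primitive_of_continuous hF')))
    (Continuous.continuousAt ((ContinuousLinearMap.toSpanSingletonCLE
      (𝕜 := ℝ) (E := ℂ)).continuous.comp hF))).hasFDerivAt
  have := HasFDerivAt.comp_hasDerivAt (f := fun y : ℝ => (y, y)) x key
    ((hasDerivAt_id x).prodMk (hasDerivAt_id x))
  refine (HasDerivAt.congr_deriv this ?_ :)
  change (ContinuousLinearMap.coprod
    (ContinuousLinearMap.toSpanSingleton ℝ (∫ t in (0 : ℝ)..x, F' x t))
    (ContinuousLinearMap.toSpanSingleton ℝ (F x x))) (1, 1) = _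
  simp [add_comm]

theorem norm_integral_le_integral_abs {f : ℝ → ℂ} {g : ℝ → ℝ} (hg : Continuous g) {v : ℝ}
    (h : ∀ t, |t| ≤ |v| → ‖f t‖ ≤ g |t|) :
    ‖∫ t in (0 : ℝ)..v, f t‖ ≤ ∫ t in (0 : ℝ)..|v|, g t := by
  have pos : ∀ {f : ℝ → ℂ} {v : ℝ}, 0 ≤ v → (∀ t, |t| ≤ |v| → ‖f t‖ ≤ g |t|) →
      ‖∫ t in (0 : ℝ)..v, f t‖ ≤ ∫ t in (0 : ℝ)..v, g t := by
    intro f v hv h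
    refine intervalIntegral.norm_integral_le_of_norm_le hv
      (Eventually.of_forall fun t ht => ?_) (hg.intervalIntegrable _ _)
    have := h t (by rw [abs_of_pos ht.1, abs_of_nonneg hv]; exact ht.2)
    rwa [abs_of_pos ht.1] at this
  rcases le_total 0 v with hv | hv
  · rw [abs_of_nonneg hv]; exact pos hv h
  · have h1 := pos (f := fun t => f (-t)) (v := -v) (by linarith)
      (fun t ht => by simpa using h (-t) (by simpa using ht))
    rw [intervalIntegral.integral_comp_neg, intervalIntegral.integral_symm] at h1
    rw [abs_of_nonpos hv]
    simpa using h1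

/-- The induction step of Picard iteration: each integration raises the power and supplies the next
factor of the factorial. -/
theorem norm_integral_le_pow {f : ℝ → ℂ} {c v : ℝ} {n : ℕ}
    (h : ∀ t, |t| ≤ |v| → ‖f t‖ ≤ c * |t| ^ n / n.factorial) :
    ‖∫ t in (0 : ℝ)..v, f t‖ ≤ c * |v| ^ (n + 1) / (n + 1).factorial := by
  refine (norm_integral_le_integral_abs (g := fun t => c * t ^ n / n.factorial)
    (by fun_prop) h).trans (le_of_eq ?_)
  simp only [mul_div_assoc, intervalIntegral.integral_const_mul,
    intervalIntegral.integral_div, integral_pow, Nat.factorial_succ]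
  push_cast
  field_simp
  simp

theorem norm_integral_le_exp {f : ℝ → ℂ} {c l v : ℝ} (hc : 0 ≤ c) (hl : 0 < l)
    (h : ∀ t, |t| ≤ |v| → ‖f t‖ ≤ c * Real.exp (l * |t|)) :
    ‖∫ t in (0 : ℝ)..v, f t‖ ≤ c / l * Real.exp (l * |v|) := by
  refine (norm_integral_le_integral_abs (g := fun t => c * Real.exp (l * t))
    (by fun_prop) h).trans ?_
  rw [intervalIntegral.integral_const_mul, intervalIntegral.integral_comp_mul_left _ hl.ne',
    integral_exp, smul_eq_mul, div_mul_eq_mul_div, mul_div_assoc, inv_mul_eq_div]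
  gcongr
  simp

theorem eq_zero_of_norm_le_pow_div_factorial {z : ℂ} {c r : ℝ}
    (h : ∀ n : ℕ, ‖z‖ ≤ c * r ^ n / n.factorial) : z = 0 := by
  have h1 : Tendsto (fun n : ℕ => c * (r ^ n / n.factorial)) atTop (𝓝 (c * 0)) :=
    (FloorSemiring.tendsto_pow_div_factorial_atTop r).const_mul c
  have h2 := ge_of_tendsto' h1 (fun n => by simpa [mul_div_assoc] using h n)
  exact norm_le_zero_iff.1 (by simpa using h2)

/-! ### Existence: Goursat solutions on the whole plane -/

/-- A solution `H` on the whole plane, together with `P = ∂H/∂v`. -/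
structure IsGlobalGoursat (q : ℝ → ℂ) (H P : ℝ → ℝ → ℂ) : Prop where
  continuous_potential : Continuous q
  continuous_solution : Continuous (Function.uncurry H)
  continuous_deriv : Continuous (Function.uncurry P)
  left : ∀ u, H u 0 = (1 / 2 : ℂ) * ∫ s in (0 : ℝ)..u, q s
  right : ∀ v, H 0 v = 0
  deriv_right : ∀ v, P 0 v = 0
  hasDerivAt : ∀ u v, HasDerivAt (H u) (P u v) v
  hasDerivAt_deriv : ∀ u v, HasDerivAt (fun u => P u v) (q (u + v) * H u v) u

/-- The iterated integral `∫₀ᵛ ∫₀ᵘ q(α + β) G(α, β) dα dβ`. -/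
noncomputable def goursatIntegral (q : ℝ → ℂ) (G : ℝ → ℝ → ℂ) (u v : ℝ) : ℂ :=
  ∫ β in (0 : ℝ)..v, ∫ α in (0 : ℝ)..u, q (α + β) * G α β

section

variable {q : ℝ → ℂ} {G G' : ℝ → ℝ → ℂ}

theorem continuous_goursat_inner (hq : Continuous q) (hG : Continuous (Function.uncurry G)) :
    Continuous fun p : ℝ × ℝ => ∫ α in (0 : ℝ)..p.1, q (α + p.2) * G α p.2 := by
  refine continuous_parametric_intervalIntegral_of_continuous
    (f := fun (p : ℝ × ℝ) α => q (α + p.2) * G α p.2) ?_ continuous_fst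
  exact (hq.comp (by fun_prop)).mul
    (hG.comp (by fun_prop : Continuous fun p : (ℝ × ℝ) × ℝ => (p.2, p.1.2)))

theorem continuous_goursatIntegral (hq : Continuous q) (hG : Continuous (Function.uncurry G)) :
    Continuous (Function.uncurry (goursatIntegral q G)) := by
  refine continuous_parametric_intervalIntegral_of_continuous
    (f := fun (p : ℝ × ℝ) β => ∫ α in (0 : ℝ)..p.1, q (α + β) * G α β) ?_ continuous_snd
  exact (continuous_goursat_inner hq hG).comp
    (by fun_prop : Continuous fun p : (ℝ × ℝ) × ℝ => (p.1.1, p.2))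

theorem continuous_mul_slice (hq : Continuous q) (hG : Continuous (Function.uncurry G)) (v : ℝ) :
    Continuous fun α => q (α + v) * G α v :=
  (hq.comp (by fun_prop)).mul (hG.comp (by fun_prop : Continuous fun α : ℝ => (α, v)))

theorem goursatIntegral_sub (hq : Continuous q) (hG : Continuous (Function.uncurry G))
    (hG' : Continuous (Function.uncurry G')) (u v : ℝ) :
    goursatIntegral q G u v - goursatIntegral q G' u v =
      goursatIntegral q (fun α β => G α β - G' α β) u v := by
  unfold goursatIntegral
  rw [← intervalIntegral.integral_sub]
  · congr 1; ext β
    rw [← intervalIntegral.integral_sub]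
    · simp only [mul_sub]
    · exact (continuous_mul_slice hq hG β).intervalIntegrable _ _
    · exact (continuous_mul_slice hq hG' β).intervalIntegrable _ _
  · exact ((continuous_goursat_inner hq hG).comp
      (Continuous.prodMk_right u)).intervalIntegrable _ _
  · exact ((continuous_goursat_inner hq hG').comp
      (Continuous.prodMk_right u)).intervalIntegrable _ _

/-- Each of the two integrations of the exponential weight gains a factor `1 / l`, so for large `l`
the integral operator is a contraction in the weighted norm. -/
theorem norm_goursatIntegral_le {M C l : ℝ} (hM : ∀ x, ‖q x‖ ≤ M) (hC : 0 ≤ C) (hl : 0 < l)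
    (h : ∀ u v, ‖G u v‖ ≤ C * Real.exp (l * (|u| + |v|))) (u v : ℝ) :
    ‖goursatIntegral q G u v‖ ≤ M * C / l ^ 2 * Real.exp (l * (|u| + |v|)) := by
  have hM0 : 0 ≤ M := (norm_nonneg _).trans (hM 0)
  have h1 : ∀ β, ‖∫ α in (0 : ℝ)..u, q (α + β) * G α β‖ ≤
      M * C * Real.exp (l * |β|) / l * Real.exp (l * |u|) := fun β => by
    refine norm_integral_le_exp (by positivity) hl fun α _ => ?_
    rw [norm_mul]
    calc _ ≤ M * (C * Real.exp (l * (|α| + |β|))) := by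
            gcongr
            exacts [hM _, h _ _]
      _ = _ := by rw [mul_add, Real.exp_add]; ring
  refine (norm_integral_le_exp (c := M * C / l * Real.exp (l * |u|)) (by positivity) hl
    fun β _ => (h1 β).trans (le_of_eq (by ring))).trans (le_of_eq ?_)
  rw [mul_add, Real.exp_add]
  field_simp

end

open BoundedContinuousFunction in
theorem exists_fixedPoint_goursatIntegral {q : ℝ → ℂ} (hq : Continuous q) {M : ℝ}
    (hM : ∀ x, ‖q x‖ ≤ M) :
    ∃ H : ℝ → ℝ → ℂ, Continuous (Function.uncurry H) ∧
      ∀ u v, H u v = (1 / 2 : ℂ) * (∫ s in (0 : ℝ)..u, q s) + goursatIntegral q H u v := by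
  have hM0 : 0 ≤ M := (norm_nonneg _).trans (hM 0)
  -- The contraction constant will be `M / l²`, which is below `1` because `M < (M + 1)²`.
  set l : ℝ := M + 1 with hl
  have hl1 : 1 ≤ l := by linarith
  have hl0 : 0 < l := by linarith
  let w : ℝ → ℝ → ℝ := fun u v => Real.exp (l * (|u| + |v|))
  have hw : Continuous (Function.uncurry w) := by
    change Continuous fun p : ℝ × ℝ => Real.exp (l * (|p.1| + |p.2|))
    fun_prop
  have hw0 : ∀ u v, 0 < w u v := fun u v => Real.exp_pos _
  have hwC : ∀ u v, (w u v : ℂ) ≠ 0 := fun u v => Complex.ofReal_ne_zero.2 (hw0 u v).ne'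
  -- The unknown is written as `w * G` with `G` bounded, which turns the weighted sup norm into the
  -- ordinary one and makes the space complete.
  let W : (ℝ × ℝ →ᵇ ℂ) → ℝ → ℝ → ℂ := fun G u v => w u v * G (u, v)
  have hWc : ∀ G, Continuous (Function.uncurry (W G)) := fun G =>
    (Complex.continuous_ofReal.comp hw).mul G.continuous
  have hWn : ∀ G u v, ‖W G u v‖ ≤ ‖G‖ * w u v := fun G u v => by
    simp only [W, norm_mul, Complex.norm_real, Real.norm_of_nonneg (hw0 u v).le]
    rw [mul_comm]
    gcongr
    exact G.norm_coe_le_norm _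
  let Q : ℝ → ℂ := fun u => (1 / 2 : ℂ) * ∫ s in (0 : ℝ)..u, q s
  have hQc : Continuous Q := continuous_const.mul
    (intervalIntegral.continuous_primitive (fun _ _ => hq.intervalIntegrable _ _) 0)
  have hQn : ∀ u v, ‖Q u‖ ≤ M * w u v := fun u v => by
    have h1 : ‖∫ s in (0 : ℝ)..u, q s‖ ≤ M * |u - 0| :=
      intervalIntegral.norm_integral_le_of_norm_le_const fun x _ => hM x
    have h2 : |u| ≤ w u v :=
      calc |u| ≤ l * (|u| + |v|) := by nlinarith [abs_nonneg u, abs_nonneg v]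
        _ ≤ l * (|u| + |v|) + 1 := by linarith
        _ ≤ _ := Real.add_one_le_exp _
    simp only [Q, norm_mul]
    rw [sub_zero] at h1
    have : ‖(1 / 2 : ℂ)‖ = 1 / 2 := by simp
    rw [this]
    nlinarith [norm_nonneg (∫ s in (0 : ℝ)..u, q s), mul_le_mul_of_nonneg_left h2 hM0,
      mul_nonneg hM0 (abs_nonneg u)]
  have hJn : ∀ G u v, ‖goursatIntegral q (W G) u v‖ ≤ M * ‖G‖ / l ^ 2 * w u v := fun G u v =>
    norm_goursatIntegral_le hM (norm_nonneg _) hl0 (hWn G) u v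
  let Φ : (ℝ × ℝ →ᵇ ℂ) → (ℝ × ℝ →ᵇ ℂ) := fun G =>
    BoundedContinuousFunction.ofNormedAddCommGroup
      (fun p => (Q p.1 + goursatIntegral q (W G) p.1 p.2) / w p.1 p.2)
      (((hQc.comp continuous_fst).add (continuous_goursatIntegral hq (hWc G))).div
        (Complex.continuous_ofReal.comp hw) (fun p => hwC _ _))
      (M + M * ‖G‖ / l ^ 2) (fun p => by
        rw [norm_div, Complex.norm_real, Real.norm_of_nonneg (hw0 _ _).le, div_le_iff₀ (hw0 _ _),
          add_mul]
        exact (norm_add_le _ _).trans (add_le_add (hQn _ _) (hJn _ _ _)))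
  have hΦ : ContractingWith (M / l ^ 2).toNNReal Φ := by
    refine ⟨?_, LipschitzWith.of_dist_le_mul fun G G' => ?_⟩
    · rw [← NNReal.coe_lt_coe, Real.coe_toNNReal _ (by positivity), NNReal.coe_one,
        div_lt_one (by positivity)]
      nlinarith
    · rw [Real.coe_toNNReal _ (by positivity), BoundedContinuousFunction.dist_le (by positivity)]
      intro p
      change dist ((Q p.1 + goursatIntegral q (W G) p.1 p.2) / (w p.1 p.2 : ℂ))
        ((Q p.1 + goursatIntegral q (W G') p.1 p.2) / (w p.1 p.2 : ℂ)) ≤ M / l ^ 2 * dist G G'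
      rw [dist_eq_norm, ← sub_div, add_sub_add_left_eq_sub, goursatIntegral_sub hq (hWc G) (hWc G'),
        norm_div, Complex.norm_real, Real.norm_of_nonneg (hw0 _ _).le, div_le_iff₀ (hw0 _ _),
        dist_eq_norm]
      have := hJn (G - G') p.1 p.2
      have e : W (G - G') = fun α β => W G α β - W G' α β := by
        funext α β
        simp [W, mul_sub]
      rw [e] at this
      exact this.trans (le_of_eq (by ring))
  obtain ⟨G, hG⟩ : ∃ G, Φ G = G := ⟨_, hΦ.fixedPoint_isFixedPt⟩
  refine ⟨W G, hWc G, fun u v => ?_⟩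
  have h1 : (Q u + goursatIntegral q (W G) u v) / (w u v : ℂ) = G (u, v) :=
    DFunLike.congr_fun hG (u, v)
  rw [div_eq_iff (hwC u v)] at h1
  exact (h1.trans (mul_comm _ _)).symm

theorem exists_isGlobalGoursat {q : ℝ → ℂ} (hq : Continuous q) {M : ℝ} (hM : ∀ x, ‖q x‖ ≤ M) :
    ∃ H P, IsGlobalGoursat q H P := by
  obtain ⟨H, hc, hH⟩ := exists_fixedPoint_goursatIntegral hq hM
  have hP := continuous_goursat_inner hq hc
  refine ⟨H, fun u v => ∫ α in (0 : ℝ)..u, q (α + v) * H α v, hq, hc, hP, fun u => ?_, fun v => ?_,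
    fun v => by simp, fun u v => ?_, fun u v => ?_⟩
  · rw [hH]; simp [goursatIntegral]
  · rw [hH]; simp [goursatIntegral]
  · have h1 := (((hP.comp (Continuous.prodMk_right u)).integral_hasStrictDerivAt 0 v).hasDerivAt
      ).const_add ((1 / 2 : ℂ) * ∫ s in (0 : ℝ)..u, q s)
    exact h1.congr_of_eventuallyEq (Eventually.of_forall fun z => hH u z)
  · exact ((continuous_mul_slice hq hc v).integral_hasStrictDerivAt 0 u).hasDerivAt

theorem IsGlobalGoursat.isGoursatSolution {q q' : ℝ → ℂ} {H P : ℝ → ℝ → ℂ}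
    (hH : IsGlobalGoursat q H P) {a : ℝ} (hq : EqOn q' q (Icc (-a) a)) :
    IsGoursatSolution a q' H where
  continuousOn := hH.continuous_solution.continuousOn
  differentiableAt u v _ := (hH.hasDerivAt u v).differentiableAt
  equation u v h := by
    have : (fun u' => deriv (fun v' => H u' v') v) = fun u' => P u' v := by
      ext u'
      exact (hH.hasDerivAt u' v).deriv
    rw [this, hq (abs_le.1 ((abs_add_le u v).trans h.le))]
    exact hH.hasDerivAt_deriv u v
  boundary_left u hu := by
    rw [hH.left]
    congr 1
    refine intervalIntegral.integral_congr fun s hs => (hq ?_).symm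
    have : uIcc 0 u ⊆ Icc (-a) a := by
      have ha : 0 ≤ a := (abs_nonneg u).trans hu
      exact uIcc_subset_Icc ⟨by linarith, ha⟩ (abs_le.1 hu)
    exact this hs
  boundary_right v _ := hH.right v

/-! ### Uniqueness for the Goursat problem -/

/-- Integrating the equation first in `u`, then in `v`, gives `D(u, v) = ∫₀ᵛ ∫₀ᵘ q D`; iterating the
resulting bound produces `C (M a |v|)ⁿ / n!` for all `n`. -/
theorem eq_zero_of_homogeneous_goursat {a : ℝ} {q : ℝ → ℂ} {D : ℝ → ℝ → ℂ}
    (hq : ContinuousOn q (Icc (-a) a)) (hD : ContinuousOn (Function.uncurry D) (diamond a))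
    (hdiff : ∀ u v : ℝ, |u| + |v| < a → DifferentiableAt ℝ (D u) v)
    (heq : ∀ u v : ℝ, |u| + |v| < a →
      HasDerivAt (fun u' => deriv (D u') v) (q (u + v) * D u v) u)
    (hleft : ∀ u, |u| ≤ a → D u 0 = 0) (hright : ∀ v, |v| ≤ a → D 0 v = 0) {u v : ℝ}
    (h : |u| + |v| < a) : D u v = 0 := by
  have mem : ∀ {x z : ℝ}, x ∈ uIcc 0 z → |x| ≤ |z| := fun {x z} hx => by
    simpa using abs_sub_left_of_mem_uIcc hx
  obtain ⟨M, hM⟩ := isCompact_Icc.exists_bound_of_continuousOn hq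
  have ha : 0 ≤ a := by linarith [abs_nonneg u, abs_nonneg v]
  have hM0 : 0 ≤ M := (norm_nonneg _).trans (hM 0 ⟨by linarith, ha⟩)
  have hcompact : IsCompact (diamond a) := by
    refine ((isCompact_Icc (a := -a) (b := a)).prod
      (isCompact_Icc (a := -a) (b := a))).of_isClosed_subset
      (isClosed_le (by fun_prop) continuous_const) fun p hp => ?_
    change |p.1| + |p.2| ≤ a at hp
    exact ⟨abs_le.1 (by linarith [abs_nonneg p.2]), abs_le.1 (by linarith [abs_nonneg p.1])⟩
  obtain ⟨C, hC⟩ := hcompact.exists_bound_of_continuousOn hD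
  have cont : ∀ u β, |u| + |β| < a → ContinuousOn (fun α => q (α + β) * D α β) (uIcc 0 u) := by
    intro u β hβ
    refine (hq.comp (by fun_prop) fun α hα => ?_).mul
      (hD.comp (f := fun α : ℝ => (α, β)) (by fun_prop) fun α hα => ?_)
    · exact abs_le.1 ((abs_add_le α β).trans (by linarith [mem hα]))
    · change |α| + |β| ≤ a
      linarith [mem hα]
  have hP : ∀ u β, |u| + |β| < a → deriv (D u) β = ∫ α in (0 : ℝ)..u, q (α + β) * D α β := by
    intro u β hβ
    -- The inner integration starts at `u = 0`, where `D` vanishes along a whole neighbourhood in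
    -- `v`.
    have h0 : deriv (D 0) β = 0 := by
      have : D 0 =ᶠ[𝓝 β] fun _ => 0 := by
        filter_upwards [Metric.ball_mem_nhds β (sub_pos.2 hβ)] with w hw
        refine hright w ?_
        rw [Metric.mem_ball, Real.dist_eq] at hw
        have := abs_add_le (w - β) β
        rw [sub_add_cancel] at this
        linarith [abs_nonneg u]
      rw [this.deriv_eq, deriv_const]
    rw [intervalIntegral.integral_eq_sub_of_hasDerivAt (f := fun u' => deriv (D u') β)
      (fun α hα => heq α β (by linarith [mem hα])) (cont u β hβ).intervalIntegrable, h0,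
      sub_zero]
  have hPn : ∀ {u β B : ℝ}, |u| + |β| < a → 0 ≤ B → (∀ α, |α| ≤ |u| → ‖D α β‖ ≤ B) →
      ‖deriv (D u) β‖ ≤ M * B * a := by
    intro u β B hβ hB hDB
    rw [hP u β hβ]
    refine (intervalIntegral.norm_integral_le_of_norm_le_const (C := M * B) fun α hα => ?_).trans
      (mul_le_mul_of_nonneg_left (by rw [sub_zero]; linarith [abs_nonneg β]) (by positivity))
    have hα' := mem (uIoc_subset_uIcc hα)
    rw [norm_mul]
    exact mul_le_mul (hM _ (abs_le.1 ((abs_add_le α β).trans (by linarith)))) (hDB α hα')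
      (norm_nonneg _) hM0
  have hC0 : 0 ≤ C := (norm_nonneg _).trans (hC (u, v) (show |u| + |v| ≤ a from h.le))
  have hDi : ∀ u v, |u| + |v| < a → D u v = ∫ β in (0 : ℝ)..v, deriv (D u) β := by
    intro u v h
    rw [intervalIntegral.integral_eq_sub_of_hasDerivAt
      (fun β hβ => (hdiff u β (by linarith [mem hβ])).hasDerivAt), hleft u
        (by linarith [abs_nonneg v]), sub_zero]
    -- The derivative in `v` is not assumed continuous in `v`; it is integrable because a derivative
    -- is measurable and `hPn` bounds it.
    refine IntervalIntegrable.mono_fun' (g := fun _ => M * C * a) intervalIntegrable_const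
      (measurable_deriv _).aestronglyMeasurable ?_
    rw [EventuallyLE, ae_restrict_iff' measurableSet_uIoc]
    refine Eventually.of_forall fun β hβ => ?_
    have hβ' := mem (uIoc_subset_uIcc hβ)
    refine hPn (by linarith) hC0 fun α hα => hC (α, β) ?_
    change |α| + |β| ≤ a
    linarith
  have main : ∀ n : ℕ, ∀ u v, |u| + |v| < a → ‖D u v‖ ≤ C * (M * a) ^ n * |v| ^ n / n.factorial := by
    intro n
    induction n with
    | zero => exact fun u v h => by simpa using hC (u, v) (show |u| + |v| ≤ a from h.le)
    | succ n ih =>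
      intro u v h
      rw [hDi u v h]
      refine norm_integral_le_pow fun β hβ => ?_
      refine (hPn (by linarith) (by positivity)
        fun α hα => ih α β (by linarith)).trans (le_of_eq ?_)
      rw [pow_succ]
      ring
  exact eq_zero_of_norm_le_pow_div_factorial (c := C) (r := M * a * |v|)
    fun n => by simpa [mul_pow, mul_assoc] using main n u v h

theorem IsGoursatSolution.eqOn {a : ℝ} (ha : 0 < a) {q : ℝ → ℂ} {H H' : ℝ → ℝ → ℂ}
    (hq : ContinuousOn q (Icc (-a) a)) (hH : IsGoursatSolution a q H)
    (hH' : IsGoursatSolution a q H') :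
    EqOn (Function.uncurry H) (Function.uncurry H') (diamond a) := by
  have hint : ∀ u v, |u| + |v| < a → H u v - H' u v = 0 := fun u v h => by
    refine eq_zero_of_homogeneous_goursat (D := fun u v => H u v - H' u v) hq
      (hH.continuousOn.sub hH'.continuousOn)
      (fun u v h => (hH.differentiableAt u v h).sub (hH'.differentiableAt u v h))
      (fun u v h => ?_) (fun u hu => ?_) (fun v hv => ?_) h
    · rw [mul_sub]
      refine ((hH.equation u v h).sub (hH'.equation u v h)).congr_of_eventuallyEq ?_
      filter_upwards [Metric.ball_mem_nhds u (sub_pos.2 h)] with w hw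
      have hw' : |w| + |v| < a := by
        rw [Metric.mem_ball, Real.dist_eq] at hw
        have := abs_add_le (w - u) u
        rw [sub_add_cancel] at this
        linarith
      exact deriv_fun_sub (hH.differentiableAt w v hw') (hH'.differentiableAt w v hw')
    · rw [hH.boundary_left u hu, hH'.boundary_left u hu, sub_self]
    · rw [hH.boundary_right v hv, hH'.boundary_right v hv, sub_self]
  rintro ⟨u, v⟩ huv
  change |u| + |v| ≤ a at huv
  -- The equation says nothing on the boundary of the square, so a boundary point is reached along
  -- the ray from the origin and equality follows by continuity.
  have hmaps : MapsTo (fun r : ℝ => (r * u, r * v)) (Icc 0 1) (diamond a) := fun r hr => by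
    change |r * u| + |r * v| ≤ a
    rw [abs_mul, abs_mul, abs_of_nonneg hr.1]
    nlinarith [hr.1, hr.2, abs_nonneg u, abs_nonneg v]
  have hc : ContinuousOn (fun r : ℝ => H (r * u) (r * v) - H' (r * u) (r * v)) (Icc 0 1) :=
    (hH.continuousOn.comp (f := fun r : ℝ => (r * u, r * v)) (by fun_prop) hmaps).sub
      (hH'.continuousOn.comp (f := fun r : ℝ => (r * u, r * v)) (by fun_prop) hmaps)
  have hz : EqOn (fun r : ℝ => H (r * u) (r * v) - H' (r * u) (r * v)) (fun _ => 0)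
      (Ico 0 1) := fun r hr => hint _ _ <| by
    rw [abs_mul, abs_mul, abs_of_nonneg hr.1]
    nlinarith [hr.1, hr.2, abs_nonneg u, abs_nonneg v]
  have := hz.of_subset_closure hc continuousOn_const Ico_subset_Icc_self
    (by rw [closure_Ico zero_ne_one]) (right_mem_Icc.2 zero_le_one)
  simpa [sub_eq_zero] using this

/-! ### Integrals along characteristics -/

/-- The integral `∫₀ˣ G(α, σ(x - α)) u(2α - x) dα` along a characteristic line. -/
noncomputable def charIntegral (G : ℝ → ℝ → ℂ) (σ : ℝ) (u : ℝ → ℂ) (x : ℝ) : ℂ :=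
  ∫ α in (0 : ℝ)..x, G α (σ * (x - α)) * u (2 * α - x)

section charIntegral

variable {G G' : ℝ → ℝ → ℂ} {σ : ℝ} {u u' v : ℝ → ℂ}

theorem continuous_charIntegrand (hG : Continuous (Function.uncurry G)) (hu : Continuous u) :
    Continuous (Function.uncurry fun x α => G α (σ * (x - α)) * u (2 * α - x)) :=
  (hG.comp (by fun_prop : Continuous fun p : ℝ × ℝ => (p.2, σ * (p.1 - p.2)))).mul
    (hu.comp (by fun_prop))

theorem continuous_charIntegrand' (hG : Continuous (Function.uncurry G)) (hu : Continuous u) :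
    Continuous (Function.uncurry fun x β => G (x - β) (σ * β) * u (x - 2 * β)) :=
  (hG.comp (by fun_prop : Continuous fun p : ℝ × ℝ => (p.1 - p.2, σ * p.2))).mul
    (hu.comp (by fun_prop))

theorem intervalIntegrable_charIntegrand (hG : Continuous (Function.uncurry G)) (hu : Continuous u)
    (x : ℝ) (a b : ℝ) :
    IntervalIntegrable (fun α => G α (σ * (x - α)) * u (2 * α - x)) volume a b :=
  ((continuous_charIntegrand hG hu).comp (Continuous.prodMk_right x)).intervalIntegrable _ _

theorem continuous_charIntegral (hG : Continuous (Function.uncurry G)) (hu : Continuous u) :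
    Continuous (charIntegral G σ u) :=
  continuous_parametric_intervalIntegral_of_continuous (continuous_charIntegrand hG hu)
    continuous_id

theorem charIntegral_sub (hG : Continuous (Function.uncurry G)) (hu : Continuous u)
    (hv : Continuous v) (x : ℝ) :
    charIntegral G σ (fun t => u t - v t) x = charIntegral G σ u x - charIntegral G σ v x := by
  unfold charIntegral
  rw [← intervalIntegral.integral_sub (intervalIntegrable_charIntegrand hG hu x _ _)
    (intervalIntegrable_charIntegrand hG hv x _ _)]
  congr 1; ext α
  ring

theorem charIntegral_eq (x : ℝ) :
    charIntegral G σ u x = ∫ β in (0 : ℝ)..x, G (x - β) (σ * β) * u (x - 2 * β) := by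
  have := intervalIntegral.integral_comp_sub_left (a := 0) (b := x)
    (fun α => G α (σ * (x - α)) * u (2 * α - x)) x
  rw [sub_self, sub_zero] at this
  rw [charIntegral, ← this]
  congr 1; ext β
  ring_nf

theorem hasDerivAt_charIntegral (hG : Continuous (Function.uncurry G))
    (hG' : Continuous (Function.uncurry G')) (hGd : ∀ u v, HasDerivAt (G u) (G' u v) v)
    (hu' : Continuous u') (hud : ∀ x, HasDerivAt u (u' x) x) (x : ℝ) :
    HasDerivAt (charIntegral G σ u)
      (G x 0 * u x + (σ * charIntegral G' σ u x - charIntegral G σ u' x)) x := by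
  have hu : Continuous u := continuous_iff_continuousAt.2 fun x => (hud x).continuousAt
  have h := hasDerivAt_integral_self (x := x) (continuous_charIntegrand (σ := σ) hG hu)
    (F' := fun x α => σ * (G' α (σ * (x - α)) * u (2 * α - x)) -
      G α (σ * (x - α)) * u' (2 * α - x))
    ((continuous_const.mul (continuous_charIntegrand hG' hu)).sub
      (continuous_charIntegrand hG hu')) (fun x α => by
        have h1 : HasDerivAt (fun y : ℝ => σ * (y - α)) σ x := by
          simpa using ((hasDerivAt_id x).sub_const α).const_mul σ
        have h2 : HasDerivAt (fun y : ℝ => 2 * α - y) (-1) x := by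
          simpa using (hasDerivAt_id x).const_sub (2 * α)
        have h3 := (HasDerivAt.scomp x (hGd α (σ * (x - α))) h1).mul
          (HasDerivAt.scomp x (hud (2 * α - x)) h2)
        refine h3.congr_deriv ?_
        simp
        ring)
  refine h.congr_deriv ?_
  rw [intervalIntegral.integral_sub ((intervalIntegrable_charIntegrand hG' hu x _ _).const_mul _)
    (intervalIntegrable_charIntegrand hG hu' x _ _), intervalIntegral.integral_const_mul,
    sub_self, mul_zero, show 2 * x - x = x by ring]
  rfl

/-- The substitution `α = x - β` moves the dependence on `x` into the first slot of `G`, so only the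
derivative of `G` in that slot is needed. This matters for `G = ∂H/∂v`, whose derivative in `v` need
not exist; the boundary term is killed by `G(0, ·) = 0`. -/
theorem hasDerivAt_charIntegral_of_left (hG : Continuous (Function.uncurry G))
    (hG' : Continuous (Function.uncurry G')) (hGd : ∀ u v, HasDerivAt (fun u => G u v) (G' u v) u)
    (hG0 : ∀ v, G 0 v = 0) (hu' : Continuous u') (hud : ∀ x, HasDerivAt u (u' x) x) (x : ℝ) :
    HasDerivAt (charIntegral G σ u) (charIntegral G' σ u x + charIntegral G σ u' x) x := by
  have hu : Continuous u := continuous_iff_continuousAt.2 fun x => (hud x).continuousAt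
  have h := hasDerivAt_integral_self (x := x) (continuous_charIntegrand' (σ := σ) hG hu)
    (F' := fun x β => G' (x - β) (σ * β) * u (x - 2 * β) + G (x - β) (σ * β) * u' (x - 2 * β))
    ((continuous_charIntegrand' hG' hu).add (continuous_charIntegrand' hG hu')) (fun x β => by
        have h1 : HasDerivAt (fun y : ℝ => y - β) 1 x := (hasDerivAt_id x).sub_const β
        have h2 : HasDerivAt (fun y : ℝ => y - 2 * β) 1 x := (hasDerivAt_id x).sub_const _
        have h3 := (HasDerivAt.scomp x (hGd (x - β) (σ * β)) h1).mul
          (HasDerivAt.scomp x (hud (x - 2 * β)) h2)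
        refine h3.congr_deriv ?_
        simp)
  have e : charIntegral G σ u = fun x => ∫ β in (0 : ℝ)..x, G (x - β) (σ * β) * u (x - 2 * β) :=
    funext charIntegral_eq
  rw [e]
  refine h.congr_deriv ?_
  have hi : ∀ {G : ℝ → ℝ → ℂ} {u : ℝ → ℂ}, Continuous (Function.uncurry G) → Continuous u →
      IntervalIntegrable (fun β => G (x - β) (σ * β) * u (x - 2 * β)) volume 0 x := fun hG hu =>
    ((continuous_charIntegrand' hG hu).comp (Continuous.prodMk_right x)).intervalIntegrable _ _
  rw [intervalIntegral.integral_add (hi hG' hu) (hi hG hu'), sub_self, hG0, zero_mul, zero_add, charIntegral_eq, charIntegral_eq]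

theorem exists_norm_charIntegral_le (hG : Continuous (Function.uncurry G)) (σ R : ℝ) :
    ∃ C, 0 ≤ C ∧ ∀ (f : ℝ → ℂ) (ε : ℝ), (∀ t, |t| ≤ R → ‖f t‖ ≤ ε) →
      ∀ x, |x| ≤ R → ‖charIntegral G σ f x‖ ≤ C * ε := by
  rcases lt_or_ge R 0 with hR | hR
  · exact ⟨0, le_rfl, fun f ε _ x hx => absurd (abs_nonneg x) (by linarith)⟩
  obtain ⟨M, hM⟩ := ((isCompact_Icc (a := -R) (b := R)).prod
    (isCompact_Icc (a := -R) (b := R))).exists_bound_of_continuousOn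
    (f := fun p : ℝ × ℝ => G p.2 (σ * (p.1 - p.2)))
    (hG.comp (by fun_prop : Continuous fun p : ℝ × ℝ => (p.2, σ * (p.1 - p.2)))).continuousOn
  have hM0 : 0 ≤ M := (norm_nonneg _).trans (hM (0, 0) ⟨⟨by simpa, hR⟩, ⟨by simpa, hR⟩⟩)
  refine ⟨M * R, by positivity, fun f ε hf x hx => ?_⟩
  have hε : 0 ≤ ε := (norm_nonneg _).trans (hf 0 (by simpa))
  calc ‖charIntegral G σ f x‖ ≤ M * ε * |x - 0| := by
        refine intervalIntegral.norm_integral_le_of_norm_le_const fun α hα => ?_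
        have h1 : |α| ≤ |x| := by simpa using abs_sub_left_of_mem_uIcc (uIoc_subset_uIcc hα)
        have h2 : |2 * α - x| ≤ |x| := by
          have := uIoc_subset_uIcc hα
          rcases le_total 0 x with h | h
          · rw [uIcc_of_le h] at this
            rw [abs_of_nonneg h, abs_le]
            constructor <;> linarith [this.1, this.2]
          · rw [uIcc_of_ge h] at this
            rw [abs_of_nonpos h, abs_le]
            constructor <;> linarith [this.1, this.2]
        rw [norm_mul]
        exact mul_le_mul (hM (x, α) ⟨abs_le.1 hx, abs_le.1 (h1.trans hx)⟩) (hf _ (h2.trans hx))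
          (norm_nonneg _) hM0
    _ ≤ M * ε * R := by
        rw [sub_zero]
        gcongr
    _ = _ := by ring

theorem two_mul_charIntegral (x : ℝ) :
    2 * charIntegral G σ u x =
      ∫ t in (-x)..x, G ((x + t) / 2) (σ * ((x - t) / 2)) * u t := by
  have := intervalIntegral.integral_comp_mul_sub (a := 0) (b := x) (c := 2)
    (fun t => G ((x + t) / 2) (σ * ((x - t) / 2)) * u t) two_ne_zero x
  rw [mul_zero, zero_sub, show 2 * x - x = x by ring] at this
  have e : charIntegral G σ u x = ∫ α in (0 : ℝ)..x,
      G ((x + (2 * α - x)) / 2) (σ * ((x - (2 * α - x)) / 2)) * u (2 * α - x) := by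
    unfold charIntegral
    congr 1; ext α
    ring_nf
  rw [e, this, Complex.real_smul]
  push_cast
  ring

end charIntegral

/-- With `t = 2α - x`, the kernel `K(x, t)` becomes `H(α, x - α)`, which is `σ = 1`; the swapped
kernel `K(t, x)` becomes `H(α, -(x - α))`, which is `σ = -1`. -/
theorem transmutation_zero (H : ℝ → ℝ → ℂ) (u : ℝ → ℂ) (x : ℝ) :
    transmutation H 0 u x = u x + 2 * charIntegral H 1 u x := by
  simp [two_mul_charIntegral, transmutation, paramKernel, kernel]

theorem swappedVolterra_zero (H : ℝ → ℝ → ℂ) (u : ℝ → ℂ) (x : ℝ) :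
    swappedVolterra H 0 u x = u x - 2 * charIntegral H (-1) u x := by
  rw [two_mul_charIntegral, swappedVolterra]
  congr 2; ext t
  simp only [paramKernel, kernel, zero_div, zero_add, zero_mul, add_zero]
  ring_nf

/-! ### The case `h = 0`: intertwining relations and the left inverse -/

/-- `u` is twice continuously differentiable with derivatives `u₁` and `u₂`. -/
structure HasC2Deriv (u u₁ u₂ : ℝ → ℂ) : Prop where
  hasDerivAt : ∀ x, HasDerivAt u (u₁ x) x
  hasDerivAt' : ∀ x, HasDerivAt u₁ (u₂ x) x
  continuous_snd : Continuous u₂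

namespace HasC2Deriv

variable {u u₁ u₂ v v₁ v₂ : ℝ → ℂ}

theorem continuous (h : HasC2Deriv u u₁ u₂) : Continuous u :=
  continuous_iff_continuousAt.2 fun x => (h.hasDerivAt x).continuousAt

theorem continuous_fst (h : HasC2Deriv u u₁ u₂) : Continuous u₁ :=
  continuous_iff_continuousAt.2 fun x => (h.hasDerivAt' x).continuousAt

theorem sub (h : HasC2Deriv u u₁ u₂) (h' : HasC2Deriv v v₁ v₂) :
    HasC2Deriv (fun x => u x - v x) (fun x => u₁ x - v₁ x) (fun x => u₂ x - v₂ x) :=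
  ⟨fun x => (h.hasDerivAt x).sub (h'.hasDerivAt x),
    fun x => (h.hasDerivAt' x).sub (h'.hasDerivAt' x), h.continuous_snd.sub h'.continuous_snd⟩

theorem add (h : HasC2Deriv u u₁ u₂) (h' : HasC2Deriv v v₁ v₂) :
    HasC2Deriv (fun x => u x + v x) (fun x => u₁ x + v₁ x) (fun x => u₂ x + v₂ x) :=
  ⟨fun x => (h.hasDerivAt x).add (h'.hasDerivAt x),
    fun x => (h.hasDerivAt' x).add (h'.hasDerivAt' x), h.continuous_snd.add h'.continuous_snd⟩

theorem const_mul (h : HasC2Deriv u u₁ u₂) (c : ℂ) :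
    HasC2Deriv (fun x => c * u x) (fun x => c * u₁ x) (fun x => c * u₂ x) :=
  ⟨fun x => (h.hasDerivAt x).const_mul c, fun x => (h.hasDerivAt' x).const_mul c,
    continuous_const.mul h.continuous_snd⟩

theorem eq_of_snd_eq (h : HasC2Deriv u u₁ u₂) (h' : HasC2Deriv v v₁ v₂) (h0 : u 0 = v 0)
    (h1 : u₁ 0 = v₁ 0) (h2 : u₂ = v₂) : u = v := by
  have hd := h.sub h'
  have e1 : ∀ x, u₁ x - v₁ x = 0 := fun x => by
    rw [is_const_of_deriv_eq_zero (f := fun x => u₁ x - v₁ x)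
      (fun y => (hd.hasDerivAt' y).differentiableAt)
      (fun y => by rw [(hd.hasDerivAt' y).deriv, h2, sub_self]) x 0, h1, sub_self]
  funext x
  have := is_const_of_deriv_eq_zero (f := fun x => u x - v x)
    (fun y => (hd.hasDerivAt y).differentiableAt)
    (fun y => by rw [(hd.hasDerivAt y).deriv, e1]) x 0
  rwa [h0, sub_self, sub_eq_zero] at this

end HasC2Deriv

namespace IsGlobalGoursat

variable {q : ℝ → ℂ} {H P : ℝ → ℝ → ℂ} (hH : IsGlobalGoursat q H P) {u u₁ u₂ v : ℝ → ℂ}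
include hH

/-- In the second derivative the terms with `P` and those with `H(x, 0) u₁(x)` cancel. What remains
comes from the boundary value, since `2 d/dx H(x, 0) = q(x)`, and from the equation `∂P/∂u = q H`.
-/
theorem hasC2Deriv_charIntegral (hu : HasC2Deriv u u₁ u₂) (σ : ℝ) :
    ∃ w, w 0 = 0 ∧ HasC2Deriv (fun x => 2 * charIntegral H σ u x) w
      (fun x => q x * u x + 2 * charIntegral H σ u₂ x +
        σ * (2 * charIntegral (fun α β => q (α + β) * H α β) σ u x)) := by
  have hqH : Continuous (Function.uncurry fun α β => q (α + β) * H α β) :=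
    (hH.continuous_potential.comp (by fun_prop : Continuous fun p : ℝ × ℝ => p.1 + p.2)).mul
      hH.continuous_solution
  have hleft : ∀ x, HasDerivAt (fun x => H x 0) (1 / 2 * q x) x := fun x => by
    rw [show (fun x => H x 0) = _ from funext hH.left]
    exact ((hH.continuous_potential.integral_hasStrictDerivAt 0 x).hasDerivAt).const_mul _
  refine ⟨fun x => 2 * (H x 0 * u x + (σ * charIntegral P σ u x - charIntegral H σ u₁ x)), ?_,
    fun x => ?_, fun x => ?_, ?_⟩
  · simp [hH.right, charIntegral]
  · exact (hasDerivAt_charIntegral hH.continuous_solution hH.continuous_deriv hH.hasDerivAt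
      hu.continuous_fst hu.hasDerivAt x).const_mul 2
  · have h1 := (hleft x).mul (hu.hasDerivAt x)
    have h2 := hasDerivAt_charIntegral_of_left (σ := σ) hH.continuous_deriv hqH hH.hasDerivAt_deriv
      hH.deriv_right hu.continuous_fst hu.hasDerivAt x
    have h3 := hasDerivAt_charIntegral (σ := σ) hH.continuous_solution hH.continuous_deriv
      hH.hasDerivAt hu.continuous_snd hu.hasDerivAt' x
    refine ((h1.add ((h2.const_mul (σ : ℂ)).sub h3)).const_mul 2).congr_deriv ?_
    ring
  · exact ((hH.continuous_potential.mul hu.continuous).add (continuous_const.mul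
      (continuous_charIntegral hH.continuous_solution hu.continuous_snd))).add
      (continuous_const.mul (continuous_const.mul (continuous_charIntegral hqH hu.continuous)))

theorem hasC2Deriv_transmutation_zero (hu : HasC2Deriv u u₁ u₂) :
    ∃ w, w 0 = u₁ 0 ∧ HasC2Deriv (transmutation H 0 u) w
      (fun x => transmutation H 0 u₂ x + q x * transmutation H 0 u x) := by
  obtain ⟨w, hw0, hw⟩ := hH.hasC2Deriv_charIntegral hu 1
  refine ⟨fun x => u₁ x + w x, by simp [hw0], ?_⟩
  · rw [show transmutation H 0 u = _ from funext (transmutation_zero H u)]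
    convert hu.add hw using 2 with x
    -- For `σ = 1` the argument `α + β` of `q` is constantly `x`, so `q` leaves the integral.
    have e : charIntegral (fun α β => q (α + β) * H α β) 1 u x = q x * charIntegral H 1 u x := by
      rw [charIntegral, charIntegral, ← intervalIntegral.integral_const_mul]
      congr 1; ext α
      rw [one_mul, add_sub_cancel]
      ring
    rw [transmutation_zero, e]
    push_cast
    ring

theorem hasC2Deriv_swappedVolterra_zero (hu : HasC2Deriv u u₁ u₂) :
    ∃ w, w 0 = u₁ 0 ∧ HasC2Deriv (swappedVolterra H 0 u) w
      (swappedVolterra H 0 (fun x => u₂ x - q x * u x)) := by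
  obtain ⟨w, hw0, hw⟩ := hH.hasC2Deriv_charIntegral hu (-1)
  refine ⟨fun x => u₁ x - w x, by simp [hw0], ?_⟩
  · rw [show swappedVolterra H 0 u = _ from funext (swappedVolterra_zero H u)]
    convert hu.sub hw using 2 with x
    -- For `σ = -1` the argument `α + β` of `q` is `2α - x`, the argument of `u`, so `q` is absorbed
    -- into `u`.
    have e : charIntegral (fun α β => q (α + β) * H α β) (-1) u x =
        charIntegral H (-1) (fun t => q t * u t) x := by
      rw [charIntegral, charIntegral]
      congr 1; ext α
      ring_nf
    rw [swappedVolterra_zero, charIntegral_sub (v := fun t => q t * u t) hH.continuous_solution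
      hu.continuous_snd (hH.continuous_potential.mul hu.continuous), e]
    push_cast
    ring

theorem continuous_transmutation_zero (hu : Continuous u) : Continuous (transmutation H 0 u) := by
  rw [show transmutation H 0 u = _ from funext (transmutation_zero H u)]
  exact hu.add (continuous_const.mul (continuous_charIntegral hH.continuous_solution hu))

theorem continuous_swappedVolterra_zero (hu : Continuous u) :
    Continuous (swappedVolterra H 0 u) := by
  rw [show swappedVolterra H 0 u = _ from funext (swappedVolterra_zero H u)]
  exact hu.sub (continuous_const.mul (continuous_charIntegral hH.continuous_solution hu))

theorem transmutation_zero_sub (hu : Continuous u) (hv : Continuous v) :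
    transmutation H 0 (fun t => u t - v t) =
      fun x => transmutation H 0 u x - transmutation H 0 v x := by
  funext x
  simp only [transmutation_zero, charIntegral_sub hH.continuous_solution hu hv]
  ring

theorem swappedVolterra_zero_sub (hu : Continuous u) (hv : Continuous v) :
    swappedVolterra H 0 (fun t => u t - v t) =
      fun x => swappedVolterra H 0 u x - swappedVolterra H 0 v x := by
  funext x
  simp only [swappedVolterra_zero, charIntegral_sub hH.continuous_solution hu hv]
  ring

/-- By the two intertwining relations the second derivative of the composite is the composite
applied to `u₂`; the values of the function and its derivative at `0` also agree. -/
theorem swappedVolterra_transmutation_of_snd (hu : HasC2Deriv u u₁ u₂)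
    (h : swappedVolterra H 0 (transmutation H 0 u₂) = u₂) :
    swappedVolterra H 0 (transmutation H 0 u) = u := by
  obtain ⟨w, hw0, hw⟩ := hH.hasC2Deriv_transmutation_zero hu
  obtain ⟨z, hz0, hz⟩ := hH.hasC2Deriv_swappedVolterra_zero hw
  refine hz.eq_of_snd_eq hu ?_ (hz0.trans hw0) ?_
  · simp [swappedVolterra, transmutation]
  · simpa using h

theorem swappedVolterra_transmutation_polynomial (p : Polynomial ℂ) :
    swappedVolterra H 0 (transmutation H 0 fun x : ℝ => p.eval (x : ℂ)) =
      fun x : ℝ => p.eval (x : ℂ) := by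
  have hp : ∀ p : Polynomial ℂ, HasC2Deriv (fun x : ℝ => p.eval (x : ℂ))
      (fun x : ℝ => p.derivative.eval (x : ℂ))
      (fun x : ℝ => p.derivative.derivative.eval (x : ℂ)) := fun p =>
    ⟨fun x => (p.hasDerivAt (x : ℂ)).comp_ofReal, fun x => (p.derivative.hasDerivAt _).comp_ofReal,
      (Polynomial.continuous _).comp Complex.continuous_ofReal⟩
  suffices ∀ n : ℕ, ∀ p : Polynomial ℂ, p.natDegree < n →
      swappedVolterra H 0 (transmutation H 0 fun x : ℝ => p.eval (x : ℂ)) =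
        fun x : ℝ => p.eval (x : ℂ) from this _ p (Nat.lt_succ_self _)
  intro n
  induction n with
  | zero => exact fun p h => absurd h (Nat.not_lt_zero _)
  | succ n ih =>
    intro p h
    refine hH.swappedVolterra_transmutation_of_snd (hp p) ?_
    -- Constants are treated separately: their `natDegree` is already `0`, so differentiation does
    -- not lower it.
    rcases Nat.eq_zero_or_pos p.natDegree with h0 | h0
    · rw [Polynomial.derivative_of_natDegree_zero h0]
      funext x
      simp [swappedVolterra, transmutation]
    · refine ih _ ?_
      have h1 := Polynomial.natDegree_derivative_le p
      have h2 := Polynomial.natDegree_derivative_le p.derivative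
      omega

end IsGlobalGoursat

theorem exists_polynomial_near {f : ℝ → ℂ} (hf : Continuous f) (R : ℝ) {ε : ℝ} (hε : 0 < ε) :
    ∃ p : Polynomial ℂ, ∀ x : ℝ, |x| ≤ R → ‖f x - p.eval (x : ℂ)‖ ≤ ε := by
  obtain ⟨p₁, h₁⟩ := exists_polynomial_near_of_continuousOn (-R) R (fun x => (f x).re)
    (Complex.continuous_re.comp hf).continuousOn (ε / 2) (by positivity)
  obtain ⟨p₂, h₂⟩ := exists_polynomial_near_of_continuousOn (-R) R (fun x => (f x).im)
    (Complex.continuous_im.comp hf).continuousOn (ε / 2) (by positivity)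
  refine ⟨p₁.map Complex.ofRealHom + Polynomial.C Complex.I * p₂.map Complex.ofRealHom,
    fun x hx => ?_⟩
  have e : ∀ p : Polynomial ℝ, (p.map Complex.ofRealHom).eval (x : ℂ) = (p.eval x : ℝ) := fun p => by
    rw [Polynomial.eval_map]
    exact Polynomial.eval₂_at_apply Complex.ofRealHom x
  rw [Polynomial.eval_add, Polynomial.eval_mul, Polynomial.eval_C, e, e]
  refine (Complex.norm_le_abs_re_add_abs_im _).trans ?_
  have h1 := h₁ x (abs_le.1 hx)
  have h2 := h₂ x (abs_le.1 hx)
  rw [abs_sub_comm] at h1 h2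
  simp
  linarith

namespace IsGlobalGoursat

variable {q : ℝ → ℂ} {H P : ℝ → ℝ → ℂ} (hH : IsGlobalGoursat q H P) {u : ℝ → ℂ}
include hH

theorem swappedVolterra_transmutation_zero (hu : Continuous u) :
    swappedVolterra H 0 (transmutation H 0 u) = u := by
  funext x
  obtain ⟨C, hC0, hC⟩ := exists_norm_charIntegral_le hH.continuous_solution 1 |x|
  obtain ⟨C', hC0', hC'⟩ := exists_norm_charIntegral_le hH.continuous_solution (-1) |x|
  -- Both operators are bounded for the sup norm on `[-|x|, |x|]`, by `1 + 2 * C` and `1 + 2 * C'`,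
  -- and the identity holds on the dense set of polynomials; the extra `1` bounds `g x` itself.
  have key : ∀ ε > 0, ‖swappedVolterra H 0 (transmutation H 0 u) x - u x‖ ≤
      ((1 + 2 * C') * (1 + 2 * C) + 1) * ε := by
    intro ε hε
    obtain ⟨p, hp⟩ := exists_polynomial_near hu |x| hε
    have hpc : Continuous fun x : ℝ => p.eval (x : ℂ) :=
      p.continuous.comp Complex.continuous_ofReal
    set g : ℝ → ℂ := fun x => u x - p.eval (x : ℂ) with hg
    have e : swappedVolterra H 0 (transmutation H 0 u) x - u x =
        swappedVolterra H 0 (transmutation H 0 g) x - g x := by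
      rw [hg, hH.transmutation_zero_sub hu hpc, hH.swappedVolterra_zero_sub
        (hH.continuous_transmutation_zero hu) (hH.continuous_transmutation_zero hpc),
        hH.swappedVolterra_transmutation_polynomial]
      ring
    have h1 : ∀ t, |t| ≤ |x| → ‖transmutation H 0 g t‖ ≤ (1 + 2 * C) * ε := fun t ht => by
      rw [transmutation_zero]
      refine (norm_add_le _ _).trans ?_
      rw [norm_mul, Complex.norm_ofNat]
      linarith [hp t ht, hC g ε hp t ht]
    have h2 : ‖swappedVolterra H 0 (transmutation H 0 g) x‖ ≤
        (1 + 2 * C') * ((1 + 2 * C) * ε) := by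
      rw [swappedVolterra_zero]
      refine (norm_sub_le _ _).trans ?_
      rw [norm_mul, Complex.norm_ofNat]
      linarith [h1 x le_rfl, hC' _ _ h1 x le_rfl]
    rw [e]
    refine (norm_sub_le _ _).trans ?_
    linarith [hp x le_rfl]
  have hK : 0 < (1 + 2 * C') * (1 + 2 * C) + 1 := by positivity
  rw [← sub_eq_zero, ← norm_le_zero_iff]
  refine le_of_forall_pos_le_add fun ε hε => ?_
  refine (key (ε / ((1 + 2 * C') * (1 + 2 * C) + 1)) (by positivity)).trans (le_of_eq ?_)
  field_simp
  ring

end IsGlobalGoursat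

/-! ### Symmetric integrals and the dependence on `h` -/

theorem integral_symm_eq {g : ℝ → ℂ} (hg : Continuous g) (x : ℝ) :
    ∫ t in (-x)..x, g t = ∫ t in (0 : ℝ)..x, (g t + g (-t)) := by
  have h := intervalIntegral.integral_comp_neg (a := 0) (b := x) g
  rw [neg_zero] at h
  have hi : IntervalIntegrable (fun t => g (-t)) volume 0 x :=
    (hg.comp continuous_neg).intervalIntegrable _ _
  rw [intervalIntegral.integral_add (hg.intervalIntegrable _ _) hi, h, add_comm,
    intervalIntegral.integral_add_adjacent_intervals (hg.intervalIntegrable _ _)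
    (hg.intervalIntegrable _ _)]

theorem integral_symm_of_odd {g : ℝ → ℂ} (hg : Continuous g) (h : ∀ t, g (-t) = -g t) (x : ℝ) :
    ∫ t in (-x)..x, g t = 0 := by
  simp [integral_symm_eq hg, h]

theorem hasDerivAt_integral_symm {F F' : ℝ → ℝ → ℂ} (hF : Continuous (Function.uncurry F))
    (hF' : Continuous (Function.uncurry F'))
    (hd : ∀ x t, HasDerivAt (fun y => F y t) (F' x t) x) (x : ℝ) :
    HasDerivAt (fun y => ∫ t in (-y)..y, F y t)
      (F x x + F x (-x) + ∫ t in (-x)..x, F' x t) x := by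
  have hneg : ∀ {G : ℝ → ℝ → ℂ}, Continuous (Function.uncurry G) →
      Continuous (Function.uncurry fun y t => G y t + G y (-t)) := fun hG =>
    hG.add (hG.comp (by fun_prop : Continuous fun p : ℝ × ℝ => (p.1, -p.2)))
  have hs : ∀ {G : ℝ → ℝ → ℂ}, Continuous (Function.uncurry G) → ∀ y,
      ∫ t in (-y)..y, G y t = ∫ t in (0 : ℝ)..y, (G y t + G y (-t)) := fun hG y =>
    integral_symm_eq (hG.comp (Continuous.prodMk_right y)) y
  rw [show (fun y => ∫ t in (-y)..y, F y t) = _ from funext (hs hF), hs hF']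
  exact hasDerivAt_integral_self (hneg hF) (hneg hF') (fun x t => (hd x t).add (hd x (-t))) x

theorem hasDerivAt_integral_symm_const {g : ℝ → ℂ} (hg : Continuous g) (x : ℝ) :
    HasDerivAt (fun y => ∫ t in (-y)..y, g t) (g x + g (-x)) x := by
  have := hasDerivAt_integral_symm (F := fun _ t => g t) (F' := fun _ _ => 0)
    (hg.comp continuous_snd) continuous_const (fun x t => hasDerivAt_const x (g t)) x
  simpa using this

theorem continuous_integral_symm {g : ℝ → ℂ} (hg : Continuous g) :
    Continuous fun x => ∫ t in (-x)..x, g t :=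
  continuous_iff_continuousAt.2 fun x => (hasDerivAt_integral_symm_const hg x).continuousAt

/-- This is `V² = 0`, the reason why `1 + (h/2) V` and `1 - (h/2) V` are inverse to each other. -/
theorem integral_symm_integral_symm {g : ℝ → ℂ} (hg : Continuous g) (x : ℝ) :
    ∫ y in (-x)..x, ∫ t in (-y)..y, g t = 0 :=
  integral_symm_of_odd (continuous_integral_symm hg)
    (fun t => by rw [neg_neg, intervalIntegral.integral_symm]) x

theorem continuous_integral_both {f : ℝ → ℝ → ℂ} (hf : Continuous (Function.uncurry f)) :
    Continuous fun p : ℝ × ℝ => ∫ s in p.2..p.1, f p.1 s := by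
  have e : (fun p : ℝ × ℝ => ∫ s in p.2..p.1, f p.1 s) =
      fun p : ℝ × ℝ => (∫ s in (0 : ℝ)..p.1, f p.1 s) - ∫ s in (0 : ℝ)..p.2, f p.1 s := by
    funext p
    have := hf.comp (Continuous.prodMk_right p.1)
    exact (intervalIntegral.integral_interval_sub_left (this.intervalIntegrable _ _)
      (this.intervalIntegrable _ _)).symm
  rw [e]
  have hf' : Continuous (Function.uncurry fun (p : ℝ × ℝ) s => f p.1 s) :=
    hf.comp (by fun_prop : Continuous fun p : (ℝ × ℝ) × ℝ => (p.1.1, p.2))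
  exact (continuous_parametric_intervalIntegral_of_continuous hf' continuous_fst).sub
    (continuous_parametric_intervalIntegral_of_continuous hf' continuous_snd)

section kernel

variable {H : ℝ → ℝ → ℂ} (hH : Continuous (Function.uncurry H)) {u : ℝ → ℂ}
include hH

theorem continuous_kernel : Continuous (Function.uncurry (kernel H)) :=
  hH.comp (by fun_prop : Continuous fun p : ℝ × ℝ => ((p.1 + p.2) / 2, (p.1 - p.2) / 2))

theorem continuous_kernel_left (x : ℝ) : Continuous (kernel H x) :=
  (continuous_kernel hH).comp (Continuous.prodMk_right x)

theorem continuous_kernel_right (x : ℝ) : Continuous fun t => kernel H t x :=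
  (continuous_kernel hH).comp (Continuous.prodMk_left x)

theorem continuous_kernel_odd :
    Continuous (Function.uncurry fun x s => kernel H x s - kernel H x (-s)) :=
  (continuous_kernel hH).sub ((continuous_kernel hH).comp
    (by fun_prop : Continuous fun p : ℝ × ℝ => (p.1, -p.2)))

theorem continuous_kernel_odd_left (x : ℝ) :
    Continuous fun s => kernel H x s - kernel H x (-s) :=
  (continuous_kernel_odd hH).comp (Continuous.prodMk_right x)

theorem integral_kernel_odd (x y : ℝ) :
    ∫ s in (-y)..y, (kernel H x s - kernel H x (-s)) = 0 :=
  integral_symm_of_odd (continuous_kernel_odd_left hH x) (fun t => by simp) y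

theorem continuous_paramKernel (h : ℂ) : Continuous (Function.uncurry (paramKernel H h)) :=
  (continuous_const.add (continuous_kernel hH)).add
    (continuous_const.mul (continuous_integral_both (continuous_kernel_odd hH)))

/-- Integration by parts moves the integral from the kernel onto `u`. Both boundary terms vanish: at
`t = x` trivially, at `t = -x` because `K(x, s) - K(x, -s)` is odd in `s`. -/
theorem transmutation_eq (hu : Continuous u) (h : ℂ) :
    transmutation H h u =
      transmutation H 0 (fun x => u x + h / 2 * ∫ t in (-x)..x, u t) := by
  funext x
  set A : ℝ → ℂ := fun t => ∫ s in t..x, (kernel H x s - kernel H x (-s)) with hA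
  set U : ℝ → ℂ := fun t => ∫ s in (0 : ℝ)..t, u s with hU
  have hk := continuous_kernel_odd_left hH x
  have hK := continuous_kernel_left hH x
  have hUd : ∀ t, HasDerivAt U (u t) t := fun t => (hu.integral_hasStrictDerivAt 0 t).hasDerivAt
  have hUc : Continuous U := continuous_iff_continuousAt.2 fun t => (hUd t).continuousAt
  have hAd : ∀ t, HasDerivAt A (-(kernel H x t - kernel H x (-t))) t := fun t =>
    intervalIntegral.integral_hasDerivAt_left (hk.intervalIntegrable _ _)
      (hk.stronglyMeasurableAtFilter _ _) hk.continuousAt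
  have hAc : Continuous A := continuous_iff_continuousAt.2 fun t => (hAd t).continuousAt
  have hV : ∀ t, ∫ s in (-t)..t, u s = U t - U (-t) := fun t =>
    (intervalIntegral.integral_interval_sub_left (hu.intervalIntegrable _ _)
      (hu.intervalIntegrable _ _)).symm
  have h1 : ∫ t in (-x)..x, A t * u t = ∫ t in (-x)..x, kernel H x t * (U t - U (-t)) := by
    rw [intervalIntegral.integral_mul_deriv_eq_deriv_mul (fun t _ => hAd t) (fun t _ => hUd t)
      (hk.neg.intervalIntegrable _ _) (hu.intervalIntegrable _ _)]
    have e1 : A x = 0 := intervalIntegral.integral_same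
    have e2 : A (-x) = 0 := integral_kernel_odd hH x x
    have e3 : ∫ t in (-x)..x, kernel H x (-t) * U t = ∫ t in (-x)..x, kernel H x t * U (-t) := by
      have := intervalIntegral.integral_comp_neg (a := -x) (b := x)
        (fun t => kernel H x t * U (-t))
      simpa using this
    have i1 : IntervalIntegrable (fun t => kernel H x t * U t) volume (-x) x :=
      (hK.mul hUc).intervalIntegrable _ _
    have i2 : IntervalIntegrable (fun t => kernel H x (-t) * U t) volume (-x) x :=
      ((hK.comp continuous_neg).mul hUc).intervalIntegrable _ _
    have i3 : IntervalIntegrable (fun t => kernel H x t * U (-t)) volume (-x) x :=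
      (hK.mul (hUc.comp continuous_neg)).intervalIntegrable _ _
    simp only [neg_mul, intervalIntegral.integral_neg, sub_mul, mul_sub]
    rw [e1, e2, intervalIntegral.integral_sub i1 i2, intervalIntegral.integral_sub i1 i3, e3]
    ring
  have e1 : transmutation H h u x = u x + ((h / 2 * ∫ t in (-x)..x, u t) +
      (∫ t in (-x)..x, kernel H x t * u t) + h / 2 * ∫ t in (-x)..x, A t * u t) := by
    rw [transmutation, ← intervalIntegral.integral_const_mul,
      ← intervalIntegral.integral_const_mul, ← intervalIntegral.integral_add,
      ← intervalIntegral.integral_add]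
    · congr 2; ext t
      rw [paramKernel]
      ring
    · exact ((continuous_const.mul hu).add (hK.mul hu)).intervalIntegrable _ _
    · exact (continuous_const.mul (hAc.mul hu)).intervalIntegrable _ _
    · exact (continuous_const.mul hu).intervalIntegrable _ _
    · exact (hK.mul hu).intervalIntegrable _ _
  have e2 : transmutation H 0 (fun x => u x + h / 2 * ∫ t in (-x)..x, u t) x =
      u x + h / 2 * (∫ t in (-x)..x, u t) + ((∫ t in (-x)..x, kernel H x t * u t) +
        h / 2 * ∫ t in (-x)..x, kernel H x t * (U t - U (-t))) := by
    rw [transmutation, ← intervalIntegral.integral_const_mul (h / 2)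
      (fun t => kernel H x t * (U t - U (-t))), ← intervalIntegral.integral_add]
    · congr 2; ext t
      rw [paramKernel, hV]
      ring
    · exact (hK.mul hu).intervalIntegrable _ _
    · exact (continuous_const.mul
        (hK.mul (hUc.sub (hUc.comp continuous_neg)))).intervalIntegrable _ _
  rw [e1, e2, h1]
  ring

/-- An exchange of the order of integration, obtained by differentiation: both sides vanish at `x =
0` and have the same derivative. -/
theorem integral_symm_kernel_swap (hu : Continuous u) (x : ℝ) :
    ∫ y in (-x)..x, ∫ t in (-y)..y, kernel H t y * u t =
      ∫ t in (-x)..x, (∫ s in t..x, (kernel H t s - kernel H t (-s))) * u t := by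
  set N : ℝ → ℂ := fun y => ∫ t in (-y)..y, kernel H t y * u t with hN
  have hNc : Continuous N := by
    have hc : Continuous (Function.uncurry fun y t => kernel H t y * u t) :=
      ((continuous_kernel hH).comp continuous_swap).mul (hu.comp continuous_snd)
    have e : N = fun y => ∫ t in (0 : ℝ)..y, (kernel H t y * u t + kernel H (-t) y * u (-t)) :=
      funext fun y => integral_symm_eq (hc.comp (Continuous.prodMk_right y)) y
    rw [e]
    exact continuous_parametric_intervalIntegral_of_continuous
      (hc.add (hc.comp (by fun_prop : Continuous fun p : ℝ × ℝ => (p.1, -p.2)))) continuous_id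
  have hFc : Continuous (Function.uncurry fun y t =>
      (∫ s in t..y, (kernel H t s - kernel H t (-s))) * u t) := by
    have h1 : Continuous fun p : ℝ × ℝ =>
        ∫ s in p.1..p.2, (kernel H p.1 s - kernel H p.1 (-s)) := by
      simp_rw [intervalIntegral.integral_symm (Prod.snd _) (Prod.fst _)]
      exact (continuous_integral_both (continuous_kernel_odd hH)).neg
    exact (h1.comp continuous_swap).mul (hu.comp continuous_snd)
  have hF'c : Continuous (Function.uncurry fun y t =>
      (kernel H t y - kernel H t (-y)) * u t) :=
    ((continuous_kernel_odd hH).comp continuous_swap).mul (hu.comp continuous_snd)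
  have hd := hasDerivAt_integral_symm hFc hF'c fun y t =>
    (((continuous_kernel_odd_left hH t).integral_hasStrictDerivAt t y).hasDerivAt).mul_const (u t)
  have hd' := hasDerivAt_integral_symm_const hNc
  have heq : ∀ y, N y + N (-y) = (∫ s in y..y, (kernel H y s - kernel H y (-s))) * u y +
      (∫ s in (-y)..y, (kernel H (-y) s - kernel H (-y) (-s))) * u (-y) +
      ∫ t in (-y)..y, (kernel H t y - kernel H t (-y)) * u t := by
    intro y
    rw [intervalIntegral.integral_same, integral_kernel_odd hH]
    simp only [hN, sub_mul]
    rw [intervalIntegral.integral_sub, neg_neg, intervalIntegral.integral_symm (-y) y]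
    · ring
    · exact ((continuous_kernel_right hH y).mul hu).intervalIntegrable _ _
    · exact ((continuous_kernel_right hH (-y)).mul hu).intervalIntegrable _ _
  have hz : ∀ y, HasDerivAt (fun x => (∫ y in (-x)..x, N y) -
      ∫ t in (-x)..x, (∫ s in t..x, (kernel H t s - kernel H t (-s))) * u t) 0 y := fun y =>
    ((hd' y).sub (hd y)).congr_deriv (by rw [heq, sub_self])
  have := is_const_of_deriv_eq_zero (fun y => (hz y).differentiableAt) (fun y => (hz y).deriv) x 0
  simpa [sub_eq_zero] using this

theorem swappedVolterra_eq (hu : Continuous u) (h : ℂ) :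
    swappedVolterra H h u = fun x => swappedVolterra H 0 u x -
      h / 2 * ∫ t in (-x)..x, swappedVolterra H 0 u t := by
  funext x
  have hK := continuous_kernel_right hH x
  have hN : Continuous fun y => ∫ t in (-y)..y, kernel H t y * u t := by
    have e : (fun y => ∫ t in (-y)..y, kernel H t y * u t) = fun y => 2 * charIntegral H (-1) u y := by
      funext y
      rw [two_mul_charIntegral]
      congr 1; ext t
      rw [kernel]
      ring_nf
    rw [e]
    exact continuous_const.mul (continuous_charIntegral hH hu)
  have hA : Continuous fun t => ∫ s in t..x, (kernel H t s - kernel H t (-s)) := by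
    simp_rw [intervalIntegral.integral_symm x _]
    exact ((continuous_integral_both (continuous_kernel_odd hH)).comp
      (Continuous.prodMk_left x)).neg
  have h0 : ∀ y, swappedVolterra H 0 u y = u y - ∫ t in (-y)..y, kernel H t y * u t := fun y => by
    simp [swappedVolterra, paramKernel]
  have e1 : swappedVolterra H h u x = u x - ((h / 2 * ∫ t in (-x)..x, u t) +
      (∫ t in (-x)..x, kernel H t x * u t) - h / 2 *
        ∫ t in (-x)..x, (∫ s in t..x, (kernel H t s - kernel H t (-s))) * u t) := by
    rw [swappedVolterra, ← intervalIntegral.integral_const_mul,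
      ← intervalIntegral.integral_const_mul, ← intervalIntegral.integral_add,
      ← intervalIntegral.integral_sub]
    · congr 2; ext t
      rw [paramKernel, intervalIntegral.integral_symm t x]
      ring
    · exact ((continuous_const.mul hu).add (hK.mul hu)).intervalIntegrable _ _
    · exact (continuous_const.mul (hA.mul hu)).intervalIntegrable _ _
    · exact (continuous_const.mul hu).intervalIntegrable _ _
    · exact (hK.mul hu).intervalIntegrable _ _
  rw [e1]
  simp only [h0]
  rw [intervalIntegral.integral_sub (hu.intervalIntegrable _ _) (hN.intervalIntegrable _ _),
    integral_symm_kernel_swap hH hu]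
  ring

/-- Picard iteration again. Folding `[-y, y]` onto `[0, y]` gives two kernel terms, whence `2 * M`.
-/
theorem eq_zero_of_swappedVolterra_zero_eq_zero (hu : Continuous u)
    (h : ∀ x, swappedVolterra H 0 u x = 0) (x : ℝ) : u x = 0 := by
  have h0 : ∀ y, u y = ∫ t in (0 : ℝ)..y, (kernel H t y * u t + kernel H (-t) y * u (-t)) :=
    fun y => by
      have := h y
      rw [swappedVolterra, sub_eq_zero] at this
      rw [this, ← integral_symm_eq (g := fun t => kernel H t y * u t)
        ((continuous_kernel_right hH y).mul hu)]
      simp [paramKernel]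
  have hbox : ∀ {s t : ℝ}, |s| ≤ |x| → |t| ≤ |x| →
      (s, t) ∈ Icc (-|x|) |x| ×ˢ Icc (-|x|) |x| := fun hs ht => ⟨abs_le.1 hs, abs_le.1 ht⟩
  obtain ⟨M, hM⟩ := ((isCompact_Icc (a := -|x|) (b := |x|)).prod
    (isCompact_Icc (a := -|x|) (b := |x|))).exists_bound_of_continuousOn
    (continuous_kernel hH).continuousOn
  have hM0 : 0 ≤ M := (norm_nonneg _).trans (hM _ (hbox le_rfl le_rfl))
  obtain ⟨C, hC⟩ := (isCompact_Icc (a := -|x|) (b := |x|)).exists_bound_of_continuousOn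
    hu.continuousOn
  have main : ∀ n : ℕ, ∀ y, |y| ≤ |x| → ‖u y‖ ≤ C * (2 * M) ^ n * |y| ^ n / n.factorial := by
    intro n
    induction n with
    | zero => exact fun y hy => by simpa using hC y (abs_le.1 hy)
    | succ n ih =>
      intro y hy
      rw [h0 y]
      refine norm_integral_le_pow fun t ht => ?_
      have hterm : ∀ s, |s| ≤ |y| →
          ‖kernel H s y * u s‖ ≤ M * (C * (2 * M) ^ n * |s| ^ n / n.factorial) := fun s hs => by
        rw [norm_mul]
        exact mul_le_mul (hM _ (hbox (hs.trans hy) hy)) (ih s (hs.trans hy)) (norm_nonneg _) hM0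
      have h1 := hterm t ht
      have h2 := hterm (-t) (by rwa [abs_neg])
      rw [abs_neg] at h2
      refine (norm_add_le _ _).trans ((add_le_add h1 h2).trans (le_of_eq ?_))
      rw [pow_succ]
      ring
  exact eq_zero_of_norm_le_pow_div_factorial (c := C) (r := 2 * M * |x|)
    fun n => by simpa [mul_pow, mul_assoc] using main n x le_rfl

end kernel

namespace IsGlobalGoursat

variable {q : ℝ → ℂ} {H P : ℝ → ℝ → ℂ} (hH : IsGlobalGoursat q H P) {u u₁ u₂ : ℝ → ℂ}
include hH

theorem transmutation_swappedVolterra_zero (hu : Continuous u) :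
    transmutation H 0 (swappedVolterra H 0 u) = u := by
  have hS := hH.continuous_swappedVolterra_zero hu
  have hT := hH.continuous_transmutation_zero hS
  funext x
  -- Since `S_0 T_0 = 1`, the operator `S_0` annihilates `T_0 S_0 u - u`, and it is injective.
  refine sub_eq_zero.1 (eq_zero_of_swappedVolterra_zero_eq_zero hH.continuous_solution
    (hT.sub hu) (fun y => ?_) x)
  have := congrFun (hH.swappedVolterra_zero_sub hT hu) y
  rw [hH.swappedVolterra_transmutation_zero hS, sub_self] at this
  exact this

theorem continuous_transmutation (hu : Continuous u) (h : ℂ) : Continuous (transmutation H h u) := by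
  rw [transmutation_eq hH.continuous_solution hu]
  exact hH.continuous_transmutation_zero
    (hu.add (continuous_const.mul (continuous_integral_symm hu)))

theorem continuous_swappedVolterra (hu : Continuous u) (h : ℂ) :
    Continuous (swappedVolterra H h u) := by
  rw [swappedVolterra_eq hH.continuous_solution hu]
  have := hH.continuous_swappedVolterra_zero hu
  exact this.sub (continuous_const.mul (continuous_integral_symm this))

theorem swappedVolterra_transmutation (hu : Continuous u) (h : ℂ) :
    swappedVolterra H h (transmutation H h u) = u := by
  have hV := continuous_integral_symm hu
  rw [swappedVolterra_eq hH.continuous_solution (hH.continuous_transmutation hu h),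
    transmutation_eq hH.continuous_solution hu, hH.swappedVolterra_transmutation_zero
      (u := fun x => u x + h / 2 * ∫ t in (-x)..x, u t) (hu.add (continuous_const.mul hV))]
  funext x
  have hi : IntervalIntegrable (fun x => h / 2 * ∫ t in (-x)..x, u t) volume (-x) x :=
    (continuous_const.mul hV).intervalIntegrable _ _
  rw [intervalIntegral.integral_add (hu.intervalIntegrable _ _) hi, intervalIntegral.integral_const_mul,
    integral_symm_integral_symm hu]
  ring

theorem transmutation_swappedVolterra (hu : Continuous u) (h : ℂ) :
    transmutation H h (swappedVolterra H h u) = u := by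
  have hS := hH.continuous_swappedVolterra_zero hu
  have hV := continuous_integral_symm hS
  rw [transmutation_eq hH.continuous_solution (hH.continuous_swappedVolterra hu h),
    swappedVolterra_eq hH.continuous_solution hu]
  convert hH.transmutation_swappedVolterra_zero hu using 2
  funext x
  have hi : IntervalIntegrable (fun x => h / 2 * ∫ t in (-x)..x, swappedVolterra H 0 u t)
      volume (-x) x := (continuous_const.mul hV).intervalIntegrable _ _
  rw [intervalIntegral.integral_sub (hS.intervalIntegrable _ _) hi, intervalIntegral.integral_const_mul,
    integral_symm_integral_symm hS]
  ring

end IsGlobalGoursat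

theorem HasC2Deriv.integral_symm {u u₁ u₂ : ℝ → ℂ} (hu : HasC2Deriv u u₁ u₂) :
    HasC2Deriv (fun x => ∫ t in (-x)..x, u t) (fun x => u x + u (-x))
      (fun x => u₁ x - u₁ (-x)) where
  hasDerivAt := hasDerivAt_integral_symm_const hu.continuous
  hasDerivAt' x := by
    have := (hu.hasDerivAt (-x)).scomp x (hasDerivAt_neg x)
    refine ((hu.hasDerivAt x).add this).congr_deriv ?_
    simp [sub_eq_add_neg]
  continuous_snd := hu.continuous_fst.sub (hu.continuous_fst.comp continuous_neg)

theorem IsGlobalGoursat.exists_hasC2Deriv_transmutation {q : ℝ → ℂ} {H P : ℝ → ℝ → ℂ}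
    (hH : IsGlobalGoursat q H P) {u u₁ u₂ : ℝ → ℂ} (hu : HasC2Deriv u u₁ u₂) (h : ℂ) :
    ∃ w₁ w₂, HasC2Deriv (transmutation H h u) w₁ w₂ := by
  rw [transmutation_eq hH.continuous_solution hu.continuous]
  obtain ⟨w, -, hw⟩ := hH.hasC2Deriv_transmutation_zero
    (hu.add (hu.integral_symm.const_mul (h / 2)))
  exact ⟨_, _, hw⟩

theorem IsGlobalGoursat.exists_hasC2Deriv_swappedVolterra {q : ℝ → ℂ} {H P : ℝ → ℝ → ℂ}
    (hH : IsGlobalGoursat q H P) {u u₁ u₂ : ℝ → ℂ} (hu : HasC2Deriv u u₁ u₂) (h : ℂ) :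
    ∃ w₁ w₂, HasC2Deriv (swappedVolterra H h u) w₁ w₂ := by
  rw [swappedVolterra_eq hH.continuous_solution hu.continuous]
  obtain ⟨w, -, hw⟩ := hH.hasC2Deriv_swappedVolterra_zero hu
  exact ⟨_, _, hw.sub (hw.integral_symm.const_mul (h / 2))⟩

/-! ### `C²` functions on an interval and their extension to the line -/

theorem HasC2Deriv.contDiff {u u₁ u₂ : ℝ → ℂ} (h : HasC2Deriv u u₁ u₂) : ContDiff ℝ 2 u := by
  have e1 : deriv u = u₁ := funext fun x => (h.hasDerivAt x).deriv
  have e2 : deriv u₁ = u₂ := funext fun x => (h.hasDerivAt' x).deriv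
  rw [show (2 : WithTop ℕ∞) = 1 + 1 from one_add_one_eq_two.symm, contDiff_succ_iff_deriv, e1,
    contDiff_one_iff_deriv, e2]
  exact ⟨fun x => (h.hasDerivAt x).differentiableAt, by simp,
    fun x => (h.hasDerivAt' x).differentiableAt, h.continuous_snd⟩

theorem eq_add_integral_of_eqOn_derivWithin {a b : ℝ} {f f' : ℝ → ℂ}
    (hf : ContDiffOn ℝ 1 f (Icc a b)) (hf' : Continuous f')
    (h : EqOn f' (derivWithin f (Icc a b)) (Icc a b)) {x : ℝ} (hx : x ∈ Icc a b) :
    f x = f a + ∫ t in a..x, f' t := by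
  rw [intervalIntegral.integral_eq_sub_of_hasDerivAt_of_le hx.1
    (hf.continuousOn.mono (Icc_subset_Icc_right hx.2)) (fun t ht => ?_)
    (hf'.intervalIntegrable _ _)]
  · ring
  · have ht' : t ∈ Ioo a b := ⟨ht.1, ht.2.trans_le hx.2⟩
    rw [h (Ioo_subset_Icc_self ht')]
    exact ((hf.differentiableOn one_ne_zero) t (Ioo_subset_Icc_self ht')).hasDerivWithinAt.hasDerivAt
      (Icc_mem_nhds ht'.1 ht'.2)

/-- The second derivative within the interval is extended by constants and integrated twice from
`a`. -/
theorem exists_hasC2Deriv_eqOn {a b : ℝ} (hab : a < b) {f : ℝ → ℂ}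
    (hf : ContDiffOn ℝ 2 f (Icc a b)) :
    ∃ u u₁ u₂, HasC2Deriv u u₁ u₂ ∧ EqOn u f (Icc a b) := by
  have hU := uniqueDiffOn_Icc hab
  set g := derivWithin f (Icc a b) with hg
  have hg1 : ContDiffOn ℝ 1 g (Icc a b) := hf.derivWithin hU (by norm_num)
  have hg2 : ContinuousOn (derivWithin g (Icc a b)) (Icc a b) :=
    hg1.continuousOn_derivWithin hU le_rfl
  set u₂ : ℝ → ℂ := IccExtend hab.le ((Icc a b).domRestrict (derivWithin g (Icc a b))) with hu₂
  have hu₂c : Continuous u₂ := (continuousOn_iff_continuous_domRestrict.1 hg2).Icc_extend'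
  have hu₂e : EqOn u₂ (derivWithin g (Icc a b)) (Icc a b) := fun x hx =>
    IccExtend_of_mem hab.le _ hx
  set u₁ : ℝ → ℂ := fun x => g a + ∫ t in a..x, u₂ t with hu₁
  have hd₁ : ∀ x, HasDerivAt u₁ (u₂ x) x := fun x =>
    ((hu₂c.integral_hasStrictDerivAt a x).hasDerivAt).const_add _
  have hu₁c : Continuous u₁ := continuous_iff_continuousAt.2 fun x => (hd₁ x).continuousAt
  have hu₁e : EqOn u₁ g (Icc a b) := fun x hx =>
    (eq_add_integral_of_eqOn_derivWithin hg1 hu₂c hu₂e hx).symm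
  refine ⟨fun x => f a + ∫ t in a..x, u₁ t, u₁, u₂, ⟨fun x =>
    ((hu₁c.integral_hasStrictDerivAt a x).hasDerivAt).const_add _, hd₁, hu₂c⟩, fun x hx => ?_⟩
  exact (eq_add_integral_of_eqOn_derivWithin (hf.of_le (by norm_num)) hu₁c hu₁e hx).symm

/-! ### Passage to the Banach space `C[-a, a]` -/

section Icc

variable {a : ℝ}

theorem neg_uIcc_subset {x : ℝ} (hx : x ∈ Icc (-a) a) : uIcc (-x) x ⊆ Icc (-a) a :=
  uIcc_subset_Icc ⟨by linarith [hx.2], by linarith [hx.1]⟩ hx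

theorem continuous_ext (ha : -a ≤ a) (u : C(Icc (-a) a, ℂ)) : Continuous (ext ha u) :=
  u.continuous.Icc_extend'

theorem ext_apply (ha : -a ≤ a) (u : C(Icc (-a) a, ℂ)) (x : Icc (-a) a) : ext ha u x = u x :=
  IccExtend_val ha _ x

theorem norm_ext_le (ha : -a ≤ a) (u : C(Icc (-a) a, ℂ)) (x : ℝ) : ‖ext ha u x‖ ≤ ‖u‖ :=
  u.norm_coe_le_norm _

/-- The operator `u ↦ u(x) + ∫_{-x}^{x} k(x, t) u(t) dt` on `C[-a, a]`. -/
noncomputable def volterraCLM (ha : -a ≤ a) (k : ℝ → ℝ → ℂ) (hk : Continuous (Function.uncurry k)) :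
    C(Icc (-a) a, ℂ) →L[ℂ] C(Icc (-a) a, ℂ) :=
  have hi : ∀ (u : C(Icc (-a) a, ℂ)) (x : ℝ),
      IntervalIntegrable (fun t => k x t * ext ha u t) volume (-x) x := fun u x =>
    ((hk.comp (Continuous.prodMk_right x)).mul (continuous_ext ha u)).intervalIntegrable _ _
  LinearMap.mkContinuousOfExistsBound
    { toFun := fun u =>
        ⟨fun x => u x + ∫ t in (-(x : ℝ))..x, k x t * ext ha u t, by
          have hc : Continuous (Function.uncurry fun x t => k x t * ext ha u t) :=
            hk.mul ((continuous_ext ha u).comp continuous_snd)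
          have e : (fun x : Icc (-a) a => ∫ t in (-(x : ℝ))..x, k x t * ext ha u t) =
              fun x : Icc (-a) a => ∫ t in (0 : ℝ)..x,
                (k x t * ext ha u t + k x (-t) * ext ha u (-t)) := funext fun x =>
            integral_symm_eq (hc.comp (Continuous.prodMk_right (x : ℝ))) x
          refine u.continuous.add ?_
          rw [e]
          refine continuous_parametric_intervalIntegral_of_continuous ?_ continuous_subtype_val
          exact (hc.comp (by fun_prop : Continuous fun p : Icc (-a) a × ℝ => ((p.1 : ℝ), p.2))).add
            (hc.comp (by fun_prop : Continuous fun p : Icc (-a) a × ℝ => ((p.1 : ℝ), -p.2)))⟩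
      map_add' := fun u v => by
        ext x
        have e : ∀ t, ext ha (u + v) t = ext ha u t + ext ha v t := fun t => rfl
        simp only [ContinuousMap.coe_mk, ContinuousMap.add_apply, e, mul_add]
        rw [intervalIntegral.integral_add (hi u x) (hi v x)]
        ring
      map_smul' := fun c u => by
        ext x
        have e : ∀ t, ext ha (c • u) t = c * ext ha u t := fun t => rfl
        simp only [ContinuousMap.coe_mk, ContinuousMap.smul_apply, e, RingHom.id_apply,
          smul_eq_mul, mul_left_comm _ c, intervalIntegral.integral_const_mul]
        ring }
    (by
      obtain ⟨M, hM⟩ := ((isCompact_Icc (a := -a) (b := a)).prod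
        (isCompact_Icc (a := -a) (b := a))).exists_bound_of_continuousOn hk.continuousOn
      have ha0 : 0 ≤ a := by linarith
      have hM0 : 0 ≤ M := (norm_nonneg _).trans (hM (0, 0) ⟨⟨by simpa, ha0⟩, ⟨by simpa, ha0⟩⟩)
      refine ⟨1 + M * (2 * a), fun u => ?_⟩
      rw [ContinuousMap.norm_le _ (by positivity)]
      intro x
      refine (norm_add_le _ _).trans ?_
      have h1 : ‖∫ t in (-(x : ℝ))..x, k x t * ext ha u t‖ ≤ M * ‖u‖ * |x - (-x : ℝ)| := by
        refine intervalIntegral.norm_integral_le_of_norm_le_const fun t ht => ?_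
        rw [norm_mul]
        exact mul_le_mul (hM (x, t) ⟨x.2, neg_uIcc_subset x.2 (uIoc_subset_uIcc ht)⟩)
          (norm_ext_le ha u t) (norm_nonneg _) hM0
      have h2 : |x - (-x : ℝ)| ≤ 2 * a := abs_le.2
        ⟨by linarith [x.2.1], by linarith [x.2.2]⟩
      have h3 := mul_le_mul_of_nonneg_left h2 (mul_nonneg hM0 (norm_nonneg u))
      linarith [u.norm_coe_le_norm x])

theorem volterraCLM_apply (ha : -a ≤ a) (k : ℝ → ℝ → ℂ) (hk : Continuous (Function.uncurry k))
    (u : C(Icc (-a) a, ℂ)) (x : Icc (-a) a) :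
    volterraCLM ha k hk u x = u x + ∫ t in (-(x : ℝ))..x, k x t * ext ha u t := rfl

variable {H H' : ℝ → ℝ → ℂ} {u v : ℝ → ℂ} {x t : ℝ}

theorem mem_diamond (hx : x ∈ Icc (-a) a) (ht : t ∈ Icc (-a) a) :
    ((x + t) / 2, (x - t) / 2) ∈ diamond a := by
  change |(x + t) / 2| + |(x - t) / 2| ≤ a
  rcases abs_cases ((x + t) / 2) with ⟨h1, -⟩ | ⟨h1, -⟩ <;>
  rcases abs_cases ((x - t) / 2) with ⟨h2, -⟩ | ⟨h2, -⟩ <;>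
  rw [h1, h2] <;> linarith [hx.1, hx.2, ht.1, ht.2]

theorem kernel_congr (h : EqOn (Function.uncurry H) (Function.uncurry H') (diamond a))
    (hx : x ∈ Icc (-a) a) (ht : t ∈ Icc (-a) a) : kernel H x t = kernel H' x t :=
  h (mem_diamond hx ht)

/-- For `x`, `t` in `[-a, a]` only values of `H` in the closed square enter, so the operators on
`[-a, a]` do not depend on which solution, or which extension of `u`, is used. -/
theorem paramKernel_congr (h : EqOn (Function.uncurry H) (Function.uncurry H') (diamond a)) (c : ℂ)
    (hx : x ∈ Icc (-a) a) (ht : t ∈ Icc (-a) a) : paramKernel H c x t = paramKernel H' c x t := by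
  rw [paramKernel, paramKernel, kernel_congr h hx ht]
  congr 2
  refine intervalIntegral.integral_congr fun s hs => ?_
  have hs' := uIcc_subset_Icc ht hx hs
  rw [kernel_congr h hx hs', kernel_congr h hx ⟨by linarith [hs'.2], by linarith [hs'.1]⟩]

theorem transmutation_congr (h : EqOn (Function.uncurry H) (Function.uncurry H') (diamond a)) (c : ℂ)
    (huv : EqOn u v (Icc (-a) a)) (hx : x ∈ Icc (-a) a) :
    transmutation H c u x = transmutation H' c v x := by
  rw [transmutation, transmutation, huv hx]
  congr 1
  refine intervalIntegral.integral_congr fun t ht => ?_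
  have ht' := neg_uIcc_subset hx ht
  rw [huv ht', paramKernel_congr h c hx ht']

theorem swappedVolterra_congr (h : EqOn (Function.uncurry H) (Function.uncurry H') (diamond a))
    (c : ℂ) (huv : EqOn u v (Icc (-a) a)) (hx : x ∈ Icc (-a) a) :
    swappedVolterra H c u x = swappedVolterra H' c v x := by
  rw [swappedVolterra, swappedVolterra, huv hx]
  congr 1
  refine intervalIntegral.integral_congr fun t ht => ?_
  have ht' := neg_uIcc_subset hx ht
  rw [huv ht', paramKernel_congr h c ht' hx]

theorem isC2_of_hasC2Deriv (ha : -a ≤ a) {f : C(Icc (-a) a, ℂ)} {u₁ u₂ : ℝ → ℂ}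
    (hu : HasC2Deriv u u₁ u₂) (h : ∀ x : Icc (-a) a, f x = u x) : IsC2 ha f :=
  hu.contDiff.contDiffOn.congr fun x hx => (ext_apply ha f ⟨x, hx⟩).trans (h ⟨x, hx⟩)

end Icc

/-- `𝐓_h` as an automorphism of `C[-a, a]`, for a solution on the whole plane. -/
noncomputable def IsGlobalGoursat.transmutationEquiv {q : ℝ → ℂ} {H P : ℝ → ℝ → ℂ}
    (hH : IsGlobalGoursat q H P) {a : ℝ} (ha : -a ≤ a) (h : ℂ) :
    C(Icc (-a) a, ℂ) ≃L[ℂ] C(Icc (-a) a, ℂ) :=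
  have hk := continuous_paramKernel hH.continuous_solution h
  have hk' : Continuous (Function.uncurry fun x t => -paramKernel H h t x) :=
    (hk.comp continuous_swap).neg
  have hS : ∀ u x, volterraCLM ha (fun x t => -paramKernel H h t x) hk' u x = swappedVolterra H h (ext ha u) x := fun u x => by
    rw [volterraCLM_apply, swappedVolterra, ext_apply]
    simp [sub_eq_add_neg]
  have hT : ∀ u x, volterraCLM ha (paramKernel H h) hk u x = transmutation H h (ext ha u) x :=
    fun u x => by rw [volterraCLM_apply, transmutation, ext_apply]
  ContinuousLinearEquiv.equivOfInverse (volterraCLM ha (paramKernel H h) hk)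
    (volterraCLM ha (fun x t => -paramKernel H h t x) hk')
    (fun u => by
      ext x
      -- The constant extension of `T_h u` and the function `T_h (ext u)` on the line agree only on
      -- `[-a, a]`, which suffices.
      rw [hS, swappedVolterra_congr (eqOn_refl _ _) h (v := transmutation H h (ext ha u))
        (fun y hy => (ext_apply ha _ ⟨y, hy⟩).trans (hT u ⟨y, hy⟩)) x.2,
        hH.swappedVolterra_transmutation (continuous_ext ha u), ext_apply])
    (fun u => by
      ext x
      rw [hT, transmutation_congr (eqOn_refl _ _) h (v := swappedVolterra H h (ext ha u))
        (fun y hy => (ext_apply ha _ ⟨y, hy⟩).trans (hS u ⟨y, hy⟩)) x.2,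
        hH.transmutation_swappedVolterra (continuous_ext ha u), ext_apply])

namespace IsGlobalGoursat

variable {q : ℝ → ℂ} {H P : ℝ → ℝ → ℂ} (hH : IsGlobalGoursat q H P) {a : ℝ}
include hH

theorem transmutationEquiv_apply (ha : -a ≤ a) (h : ℂ) (u : C(Icc (-a) a, ℂ)) (x : Icc (-a) a) :
    hH.transmutationEquiv ha h u x = transmutation H h (ext ha u) x := by
  rw [transmutation, ext_apply]
  rfl

theorem transmutationEquiv_symm_apply (ha : -a ≤ a) (h : ℂ) (u : C(Icc (-a) a, ℂ))
    (x : Icc (-a) a) :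
    (hH.transmutationEquiv ha h).symm u x = swappedVolterra H h (ext ha u) x := by
  have : (hH.transmutationEquiv ha h).symm u x =
      u x + ∫ t in (-(x : ℝ))..x, -paramKernel H h t x * ext ha u t := rfl
  simp [this, swappedVolterra, ext_apply, sub_eq_add_neg]

theorem isC2_transmutationEquiv_iff (ha : -a < a) (h : ℂ) (u : C(Icc (-a) a, ℂ)) :
    IsC2 ha.le u ↔ IsC2 ha.le (hH.transmutationEquiv ha.le h u) := by
  constructor
  · intro hu
    obtain ⟨v, v₁, v₂, hv, he⟩ := exists_hasC2Deriv_eqOn ha hu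
    obtain ⟨w₁, w₂, hw⟩ := hH.exists_hasC2Deriv_transmutation hv h
    exact isC2_of_hasC2Deriv ha.le hw fun x => (hH.transmutationEquiv_apply ha.le h u x).trans
      (transmutation_congr (eqOn_refl _ _) h he.symm x.2)
  · intro hu
    obtain ⟨v, v₁, v₂, hv, he⟩ := exists_hasC2Deriv_eqOn ha hu
    obtain ⟨w₁, w₂, hw⟩ := hH.exists_hasC2Deriv_swappedVolterra hv h
    refine isC2_of_hasC2Deriv ha.le hw fun x => ?_
    rw [← swappedVolterra_congr (eqOn_refl _ _) h he.symm x.2,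
      ← hH.transmutationEquiv_symm_apply, ContinuousLinearEquiv.symm_apply_apply]

end IsGlobalGoursat

theorem exists_isGlobalGoursat_eqOn {a : ℝ} (ha : -a ≤ a) {q : ℝ → ℂ}
    (hq : ContinuousOn q (Icc (-a) a)) :
    ∃ q' H P, IsGlobalGoursat q' H P ∧ EqOn q q' (Icc (-a) a) := by
  obtain ⟨M, hM⟩ := isCompact_Icc.exists_bound_of_continuousOn hq
  obtain ⟨H, P, hH⟩ := exists_isGlobalGoursat (q := IccExtend ha ((Icc (-a) a).domRestrict q))
    (continuousOn_iff_continuous_domRestrict.1 hq).Icc_extend' (M := M)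
    (fun x => hM _ (projIcc (-a) a ha x).2)
  exact ⟨_, H, P, hH, fun x hx => (IccExtend_of_mem ha ((Icc (-a) a).domRestrict q) hx).symm⟩

end Transmutation

theorem mainTheorem6 (a : ℝ) (ha : 0 < a) (q : ℝ → ℂ)
    (hq : ContinuousOn q (Set.Icc (-a) a)) :
    (∃ H : ℝ → ℝ → ℂ, Transmutation.IsGoursatSolution a q H ∧
      ∀ H' : ℝ → ℝ → ℂ, Transmutation.IsGoursatSolution a q H' →
        Set.EqOn (Function.uncurry H') (Function.uncurry H) (Transmutation.diamond a)) ∧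
    ∀ H : ℝ → ℝ → ℂ, Transmutation.IsGoursatSolution a q H → ∀ h : ℂ,
      ∃ T : C(Set.Icc (-a) a, ℂ) ≃L[ℂ] C(Set.Icc (-a) a, ℂ),
        (∀ (u : C(Set.Icc (-a) a, ℂ)) (x : Set.Icc (-a) a),
          T u x = Transmutation.transmutation H h
            (Transmutation.ext (neg_le_self ha.le) u) x) ∧
        (∀ (u : C(Set.Icc (-a) a, ℂ)) (x : Set.Icc (-a) a),
          T.symm u x = Transmutation.swappedVolterra H h
            (Transmutation.ext (neg_le_self ha.le) u) x) ∧
        ∀ u : C(Set.Icc (-a) a, ℂ),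
          Transmutation.IsC2 (neg_le_self ha.le) u ↔
            Transmutation.IsC2 (neg_le_self ha.le) (T u) := by
  obtain ⟨q', G, P, hG, hqq'⟩ :=
    Transmutation.exists_isGlobalGoursat_eqOn (neg_le_self ha.le) hq
  have hG' := hG.isGoursatSolution hqq'
  refine ⟨⟨G, hG', fun H' hH' => hH'.eqOn ha hq hG'⟩, fun H hH h => ?_⟩
  -- The given `H` is traded for the global solution `G`; they coincide wherever the operators on
  -- `[-a, a]` evaluate them.
  have hHG := hG'.eqOn ha hq hH
  refine ⟨hG.transmutationEquiv (neg_le_self ha.le) h, fun u x => ?_, fun u x => ?_,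
    hG.isC2_transmutationEquiv_iff (neg_lt_self ha) h⟩
  · rw [hG.transmutationEquiv_apply]
    exact Transmutation.transmutation_congr hHG h (Set.eqOn_refl _ _) x.2
  · rw [hG.transmutationEquiv_symm_apply]
    exact Transmutation.swappedVolterra_congr hHG h (Set.eqOn_refl _ _) x.2
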